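/- For graphs $G,H$ let $G+H$ denote their join (the disjoint union of $G$ and $H$ together with all edges between $G$ and $H$), and let $nG$ denote the join of $n$ copies of $G$. An embedding of a finite graph in $S^3$ is tame if some homeomorphism of $S^3$ carries its image to a finite union of great circle arcs. A graph is achirally embeddable in $S^3$ if it has a tame embedding $\Gamma$ in $S^3$ for which there is an ambient isotopy of $S^3$ taking $\Gamma$ to its mirror image, with vertices going to vertices. **Theorem.** Let $\gamma$ be a complete multipartite graph of the form $$\gamma = 4G_1+2G_2+G_3+K_{q_1,q_2,q_3},$$ where $G_1,G_2,G_3$ and $K_{q_1,q_2,q_3}$ are (possibly empty) finite complete multipartite graphs, $q_1,q_2,q_3\ge 0$, such that all partite sets of $G_2$ have even size and all partite sets of $G_3$ have size divisible by $4$. Suppose that one of the following conditions holds: 1. two or three of the $q_i$ are $0$; 2. two of the $q_i$ are odd and equal, and the third is $0$; 3. two of the $q_i$ are odd and equal, the third is $\equiv 1 \pmod 4$, and $G_1=\emptyset$; 4. one $q_i\equiv 2 \pmod 4$, one $q_i\equiv 1 \pmod 4$, and the third is $0$; 5. two of the $q_i$ are $\equiv 2 \pmod 4$, the third is $0$, and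 $G_1=\emptyset$. Then $\gamma$ is achirally embeddable in $S^3$. -/

import Mathlib

/-- The join `G + H`: the disjoint union of `G` and `H` together with all edges between them. -/
def SimpleGraph.join {V W : Type*} (G : SimpleGraph V) (H : SimpleGraph W) :
    SimpleGraph (V ⊕ W) :=
  (G ⊕g H) ⊔ completeBipartiteGraph V W

/-- The join `nG` of `n` copies of `G`; the vertex `(i, v)` is the vertex `v` of the `i`-th copy. -/
def SimpleGraph.joinCopies {V : Type*} (n : ℕ) (G : SimpleGraph V) : SimpleGraph (Fin n × V) where
  Adj x y := x.1 ≠ y.1 ∨ G.Adj x.2 y.2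
  symm := ⟨fun _ _ h => h.imp Ne.symm fun h' => h'.symm⟩
  loopless := ⟨fun x h => h.elim (fun h' => h' rfl) fun h' => G.loopless.irrefl x.2 h'⟩

/-- The complete multipartite graph `K_{m 0, …, m (k-1)}`; some of the sizes may be `0`. -/
abbrev completeMultipartite {k : ℕ} (m : Fin k → ℕ) : SimpleGraph (Σ i, Fin (m i)) :=
  SimpleGraph.completeMultipartiteGraph fun i => Fin (m i)

/-- The 3-sphere. -/
abbrev S3 : Type := Metric.sphere (0 : EuclideanSpace ℝ (Fin 4)) 1

/-- The reflection of the 3-sphere in an equatorial 2-sphere. -/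
noncomputable def S3.mirror (x : S3) : S3 :=
  ⟨!₂[-x.1 0, x.1 1, x.1 2, x.1 3], by
    have h : ‖x.1‖ = 1 := mem_sphere_zero_iff_norm.mp x.2
    rw [EuclideanSpace.norm_eq] at h
    rw [mem_sphere_zero_iff_norm, EuclideanSpace.norm_eq]
    simpa [Fin.sum_univ_four] using h⟩

/-- For `q ≠ -p`, the shortest great circle arc between `p` and `q` (the point `p` if `p = q`). -/
def S3.geodesicArc (p q : S3) : Set S3 :=
  {x | ∃ a b : ℝ, 0 ≤ a ∧ 0 ≤ b ∧ x.1 = a • p.1 + b • q.1}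

/-- A subset of the 3-sphere is tame (as a one-dimensional object) if some homeomorphism of the
3-sphere carries it to a finite union of geodesic arcs. -/
def S3.IsTame (A : Set S3) : Prop :=
  ∃ (φ : S3 ≃ₜ S3) (s : Finset (S3 × S3)), (∀ p ∈ s, p.2 ≠ -p.1) ∧
    φ '' A = ⋃ p ∈ s, S3.geodesicArc p.1 p.2

/-- An ambient isotopy of the 3-sphere: a continuous family of homeomorphisms that starts at the
identity. -/
structure S3.AmbientIsotopy where
  toFun : unitInterval → S3 ≃ₜ S3
  continuous_toFun : Continuous fun p : unitInterval × S3 => toFun p.1 p.2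
  map_zero : toFun 0 = Homeomorph.refl S3

/-- A (topological) embedding of a graph in the 3-sphere: vertices go to distinct points, the edge
`uv` goes to an arc from the image of `u` to the image of `v` that contains no other
vertex, and distinct edges meet only in vertices. -/
structure SpatialEmbedding {V : Type*} (G : SimpleGraph V) where
  vert : V → S3
  arc : G.edgeSet → Set S3
  vert_injective : Function.Injective vert
  arc_eq_range : ∀ (u v : V) (h : G.Adj u v), ∃ γ : Path (vert u) (vert v),
    Function.Injective γ ∧ arc ⟨s(u, v), h⟩ = Set.range γ
  vert_mem_arc : ∀ (e : G.edgeSet) (w : V), vert w ∈ arc e → w ∈ e.1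
  arc_inter_arc : ∀ e e' : G.edgeSet, e ≠ e' → arc e ∩ arc e' ⊆ Set.range vert

/-- The embedded graph as a set of points. -/
def SpatialEmbedding.carrier {V : Type*} {G : SimpleGraph V} (Γ : SpatialEmbedding G) : Set S3 :=
  Set.range Γ.vert ∪ ⋃ e, Γ.arc e

/-- An embedded graph is achiral if an ambient isotopy takes it to its mirror image, as a set of
points with a distinguished set of vertices. -/
def SpatialEmbedding.IsAchiral {V : Type*} {G : SimpleGraph V} (Γ : SpatialEmbedding G) : Prop :=
  ∃ F : S3.AmbientIsotopy,
    F.toFun 1 '' Γ.carrier = S3.mirror '' Γ.carrier ∧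
    F.toFun 1 '' Set.range Γ.vert = S3.mirror '' Set.range Γ.vert

/-- A graph is achirally embeddable in the 3-sphere if it has a (tame) achiral embedding. -/
def SimpleGraph.AchirallyEmbeddable {V : Type*} (G : SimpleGraph V) : Prop :=
  ∃ Γ : SpatialEmbedding G, S3.IsTame Γ.carrier ∧ Γ.IsAchiral

/-!
Let `ρ` be the rotoreflection of order four of the 3-sphere: a quarter turn in one plane followed by
a reflection in the orthogonal plane. The quarter turn is isotopic to the identity, so a graph
embedded with great circle arcs is achiral as soon as `ρ` preserves it.

Place most vertices in free orbits of `ρ`, at the points over `(re z², z, 1)` with `z` on the unit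
circle of `ℂ`, where `ρ` acts by `z ↦ i z`. A hyperplane through three points `x`, `y`, `w` of this
curve meets it again only at `(x y w)⁻¹`, so if every `z` lies slightly ahead of a fourth root of
unity, then any four of these points are linearly independent and their arcs do not cross. The other
vertices lie on the circle fixed by `ρ²`, which `ρ` reflects. Their arcs on the circle can meet only
arcs from `v` to `ρ² v`; there are none if `ρ²` preserves every partite set, and they are avoided if
the vertices of the circle are close to a fixed point of the reflection.

The four copies of each partite set of `G₁` are permuted cyclically by `ρ`, the two copies of each
partite set of `G₂` are exchanged and the partite sets of `G₃` are preserved. In `K_{q₁,q₂,q₃}` the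
symmetry preserves all partite sets or exchanges two equal ones, and at most four vertices are left
over for the circle.
-/

/-! ### Cones over graphs -/

/-- The cone over a graph: the nonnegative weightings of its vertices that are supported on a vertex
or on an edge, together with `0`. -/
def edgeCone {V : Type*} (G : SimpleGraph V) : Set (V →₀ ℝ) :=
  {a | 0 ≤ a ∧ a.support.card ≤ 2 ∧ G.IsClique a.support}

/-- The placement `P` of the vertices of `G`, extended linearly over the edges, embeds the cone
over `G`; when `E` is a Euclidean space, radial projection then embeds `G` in the unit sphere with
great circle arcs as edges. -/
def IsConeEmbedding {V E : Type*} [AddCommGroup E] [Module ℝ E] (G : SimpleGraph V) (P : V → E) :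
    Prop :=
  Set.InjOn (Finsupp.linearCombination ℝ P) (edgeCone G)

section ConeEmbedding

variable {V W E : Type*} {G : SimpleGraph V} {H : SimpleGraph W}

theorem mem_edgeCone_of_support_subset {s : Finset V} (hs : s.card ≤ 2) (hG : G.IsClique s)
    {a : V →₀ ℝ} (ha : 0 ≤ a) (hsub : a.support ⊆ s) : a ∈ edgeCone G :=
  ⟨ha, (Finset.card_le_card hsub).trans hs, hG.subset (Finset.coe_subset.mpr hsub)⟩

theorem single_mem_edgeCone (v : V) {c : ℝ} (hc : 0 ≤ c) : Finsupp.single v c ∈ edgeCone G :=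
  mem_edgeCone_of_support_subset (s := {v}) (by simp) (by simp) (Finsupp.single_nonneg.mpr hc)
    Finsupp.support_single_subset

theorem mem_edgeCone_of_adj {u v : V} (h : G.Adj u v) {a : V →₀ ℝ} (ha : 0 ≤ a)
    (hsub : (a.support : Set V) ⊆ {u, v}) : a ∈ edgeCone G := by
  classical
  refine mem_edgeCone_of_support_subset (s := {u, v}) Finset.card_le_two ?_ ha
    (Finset.coe_subset.mp (by simpa using hsub))
  simpa [SimpleGraph.isClique_pair] using fun _ => h

theorem mem_edgeCone_of_mem_edgeSet {e : Sym2 V} (he : e ∈ G.edgeSet) {a : V →₀ ℝ} (ha : 0 ≤ a)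
    (hsub : ∀ v ∈ a.support, v ∈ e) : a ∈ edgeCone G := by
  induction e using Sym2.ind with
  | _ u v => exact mem_edgeCone_of_adj he ha fun w hw => by simpa using hsub w hw

theorem embDomain_mem_edgeCone (e : G ↪g H) {a : V →₀ ℝ} (ha : a ∈ edgeCone G) :
    a.embDomain e.toEmbedding ∈ edgeCone H := by
  obtain ⟨h0, hcard, hclique⟩ := ha
  refine ⟨fun w => ?_, by simpa using hcard, ?_⟩
  · by_cases hw : w ∈ Set.range e.toEmbedding
    · obtain ⟨v, rfl⟩ := hw
      rw [Finsupp.embDomain_apply_self]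
      exact h0 v
    · rw [Finsupp.embDomain_of_notMem_range _ _ _ hw, Finsupp.zero_apply]
  · rw [Finsupp.support_embDomain, Finset.coe_map]
    rintro _ ⟨u, hu, rfl⟩ _ ⟨v, hv, rfl⟩ huv
    exact e.map_adj_iff.mpr (hclique hu hv fun h => huv (congrArg _ h))

namespace IsConeEmbedding

variable [AddCommGroup E] [Module ℝ E] {P : V → E}

theorem comp {P : W → E} (h : IsConeEmbedding H P) (e : G ↪g H) : IsConeEmbedding G (P ∘ e) := by
  intro a ha b hb hab
  refine Finsupp.embDomain_injective e.toEmbedding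
    (h (embDomain_mem_edgeCone e ha) (embDomain_mem_edgeCone e hb) ?_)
  rwa [Finsupp.linearCombination_embDomain, Finsupp.linearCombination_embDomain]

theorem smul (h : IsConeEmbedding G P) {c : V → ℝ} (hc : ∀ v, 0 < c v) :
    IsConeEmbedding G fun v => c v • P v := by
  have hsum : ∀ a : V →₀ ℝ, Finsupp.linearCombination ℝ (fun v => c v • P v) a =
      Finsupp.linearCombination ℝ P (c • a) := fun a => by
    rw [Finsupp.linearCombination_apply, Finsupp.linearCombination_apply,
      Finsupp.sum_of_support_subset (c • a) (s := a.support) (fun v hv => by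
        simp_all) _ (by simp)]
    simp [Finsupp.sum, smul_smul, mul_comm]
  have hmem : ∀ a ∈ edgeCone G, c • a ∈ edgeCone G := fun a ha =>
    mem_edgeCone_of_support_subset ha.2.1 ha.2.2 (fun v => mul_nonneg (hc v).le (ha.1 v))
      fun v hv => by simp_all
  intro a ha b hb hab
  rw [hsum, hsum] at hab
  ext v
  exact mul_left_cancel₀ (hc v).ne' (DFunLike.congr_fun (h (hmem a ha) (hmem b hb) hab) v)

/-- Splitting a linear relation into its positive and negative parts gives two points of the edge
cone with the same image. -/
theorem linearIndepOn (h : IsConeEmbedding G P) {s : Finset V} (hs : s.card ≤ 2)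
    (hG : G.IsClique s) : LinearIndepOn ℝ P (s : Set V) := by
  rw [linearIndepOn_iff]
  intro l hl hl0
  have hsub : l.support ⊆ s := by simpa [Finsupp.mem_supported] using hl
  have hmem : ∀ l' : V →₀ ℝ, 0 ≤ l' → (∀ v, l v = 0 → l' v = 0) → l' ∈ edgeCone G :=
    fun l' h0 h' => mem_edgeCone_of_support_subset hs hG h0 fun v hv =>
      hsub (Finsupp.mem_support_iff.mpr (mt (h' v) (Finsupp.mem_support_iff.mp hv)))
  have hpos : l⁺ ∈ edgeCone G := hmem _ (posPart_nonneg l) fun v hv => by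
    simp [posPart, hv]
  have hneg : l⁻ ∈ edgeCone G := hmem _ (negPart_nonneg l) fun v hv => by
    simp [negPart, hv]
  rw [← posPart_sub_negPart l] at hl0 ⊢
  rw [map_sub, sub_eq_zero] at hl0
  rw [h hpos hneg hl0, sub_self]

theorem ne_zero (h : IsConeEmbedding G P) (v : V) : P v ≠ 0 :=
  linearIndepOn_singleton_iff (R := ℝ) |>.mp (by
    simpa using h.linearIndepOn (s := {v}) (by simp) (by simp))

theorem linearIndepOn_pair (h : IsConeEmbedding G P) {u v : V} (huv : G.Adj u v) :
    LinearIndepOn ℝ P {u, v} := by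
  classical
  simpa using h.linearIndepOn (s := {u, v}) Finset.card_le_two (by
    simpa [SimpleGraph.isClique_pair] using fun _ => huv)

end IsConeEmbedding

end ConeEmbedding

/-! ### Symmetric embeddings in the 3-sphere -/

/-- Euclidean four-space. -/
abbrev E4 : Type := EuclideanSpace ℝ (Fin 4)

namespace E4

theorem norm_eq_of_sq {x y : E4}
    (h : x 0 ^ 2 + x 1 ^ 2 + x 2 ^ 2 + x 3 ^ 2 = y 0 ^ 2 + y 1 ^ 2 + y 2 ^ 2 + y 3 ^ 2) :
    ‖x‖ = ‖y‖ := by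
  simp only [EuclideanSpace.norm_eq, Fin.sum_univ_four, Real.norm_eq_abs, sq_abs, h]

/-- The rotation by the angle `θ` in the plane of the middle coordinates. -/
noncomputable def rotate (θ : ℝ) (x : E4) : E4 :=
  !₂[x 0, Real.cos θ * x 1 - Real.sin θ * x 2, Real.sin θ * x 1 + Real.cos θ * x 2, x 3]

theorem norm_rotate (θ : ℝ) (x : E4) : ‖rotate θ x‖ = ‖x‖ := by
  apply norm_eq_of_sq
  simp only [rotate, PiLp.toLp_apply, Matrix.cons_val]
  linear_combination (x 1 ^ 2 + x 2 ^ 2) * Real.sin_sq_add_cos_sq θ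

theorem rotate_rotate_of_add_eq_zero {θ η : ℝ} (h : θ + η = 0) (x : E4) :
    rotate θ (rotate η x) = x := by
  obtain rfl : η = -θ := by linarith
  have hs := Real.sin_sq_add_cos_sq θ
  ext i
  fin_cases i
  · simp [rotate]
  · simp only [rotate, Real.cos_neg, Real.sin_neg, Fin.mk_one, PiLp.toLp_apply, Matrix.cons_val]
    linear_combination x 1 * hs
  · simp only [rotate, Real.cos_neg, Real.sin_neg, Fin.reduceFinMk, PiLp.toLp_apply,
      Matrix.cons_val]
    linear_combination x 2 * hs
  · simp [rotate]

/-- The quarter turn in the plane of the middle coordinates followed by the reflection in the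
first coordinate. -/
noncomputable def rotoreflect : E4 →ₗ[ℝ] E4 where
  toFun x := !₂[-x 0, -x 2, x 1, x 3]
  map_add' x y := by ext i; fin_cases i <;> simp <;> ring
  map_smul' a x := by ext i; fin_cases i <;> simp

theorem rotoreflect_apply (x : E4) : rotoreflect x = !₂[-x 0, -x 2, x 1, x 3] := rfl

theorem norm_rotoreflect (x : E4) : ‖rotoreflect x‖ = ‖x‖ := by
  apply norm_eq_of_sq
  simp only [rotoreflect_apply, PiLp.toLp_apply, Matrix.cons_val]
  ring

theorem rotoreflect_four (x : E4) :
    rotoreflect (rotoreflect (rotoreflect (rotoreflect x))) = x := by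
  ext i; fin_cases i <;> simp [rotoreflect_apply]

end E4

namespace S3

theorem norm_coe (x : S3) : ‖x.1‖ = 1 := mem_sphere_zero_iff_norm.mp x.2

/-- The rotation of the 3-sphere by the angle `θ` in the plane of the middle coordinates. -/
noncomputable def rotate (θ : ℝ) (x : S3) : S3 :=
  ⟨E4.rotate θ x.1, by rw [mem_sphere_zero_iff_norm, E4.norm_rotate, norm_coe]⟩

theorem continuous_rotate : Continuous fun p : ℝ × S3 => rotate p.1 p.2 := by
  refine Continuous.subtype_mk ?_ _
  refine (PiLp.continuous_toLp 2 _).comp (continuous_pi fun i => ?_)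
  have h : ∀ i : Fin 4, Continuous fun p : ℝ × S3 => p.2.1 i := fun i => by fun_prop
  have h0 := h 0
  have h1 := h 1
  have h2 := h 2
  have h3 := h 3
  fin_cases i
  · exact h0
  · exact ((Real.continuous_cos.comp continuous_fst).mul h1).sub
      ((Real.continuous_sin.comp continuous_fst).mul h2)
  · exact ((Real.continuous_sin.comp continuous_fst).mul h1).add
      ((Real.continuous_cos.comp continuous_fst).mul h2)
  · exact h3

/-- `S3.rotate` as a homeomorphism. -/
noncomputable def rotateHomeomorph (θ : ℝ) : S3 ≃ₜ S3 where
  toFun := rotate θ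
  invFun := rotate (-θ)
  left_inv x := Subtype.ext (E4.rotate_rotate_of_add_eq_zero (by ring) x.1)
  right_inv x := Subtype.ext (E4.rotate_rotate_of_add_eq_zero (by ring) x.1)
  continuous_toFun := continuous_rotate.comp (by fun_prop : Continuous fun x : S3 => (θ, x))
  continuous_invFun := continuous_rotate.comp (by fun_prop : Continuous fun x : S3 => (-θ, x))

/-- The ambient isotopy from the identity to the quarter turn. -/
noncomputable def quarterTurn : S3.AmbientIsotopy where
  toFun t := rotateHomeomorph (t * (Real.pi / 2))
  continuous_toFun := continuous_rotate.comp
    (by fun_prop : Continuous fun p : unitInterval × S3 => ((p.1 : ℝ) * (Real.pi / 2), p.2))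
  map_zero := by
    ext x i
    fin_cases i <;> simp [rotateHomeomorph, rotate, E4.rotate]

/-- The rotoreflection of the 3-sphere of order four. -/
noncomputable def rotoreflect (x : S3) : S3 :=
  ⟨E4.rotoreflect x.1, by rw [mem_sphere_zero_iff_norm, E4.norm_rotoreflect, norm_coe]⟩

theorem rotoreflect_four (x : S3) :
    rotoreflect (rotoreflect (rotoreflect (rotoreflect x))) = x :=
  Subtype.ext (E4.rotoreflect_four x.1)

theorem quarterTurn_one (x : S3) : quarterTurn.toFun 1 x = mirror (rotoreflect x) := by
  ext i
  fin_cases i <;>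
    simp [quarterTurn, rotateHomeomorph, rotate, E4.rotate, mirror, rotoreflect,
      E4.rotoreflect_apply]

theorem image_rotoreflect_eq {A : Set S3} (h : Set.MapsTo rotoreflect A A) :
    rotoreflect '' A = A :=
  h.image_subset.antisymm fun x hx => ⟨_, h (h (h hx)), rotoreflect_four x⟩

theorem quarterTurn_one_image {A : Set S3} (h : Set.MapsTo rotoreflect A A) :
    quarterTurn.toFun 1 '' A = mirror '' A := by
  conv_rhs => rw [← image_rotoreflect_eq h, Set.image_image]
  exact Set.image_congr fun x _ => quarterTurn_one x

theorem geodesicArc_self (p : S3) : geodesicArc p p = {p} := by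
  ext x
  constructor
  · rintro ⟨a, b, ha, hb, h⟩
    rw [← add_smul] at h
    have h1 : a + b = 1 := by
      have := norm_coe x
      rwa [h, norm_smul, norm_coe, mul_one, Real.norm_of_nonneg (by positivity)] at this
    rw [h1, one_smul] at h
    exact Subtype.ext h
  · rintro rfl
    exact ⟨1, 0, zero_le_one, le_rfl, by simp⟩

theorem rotoreflect_mem_geodesicArc {p q x : S3} (h : x ∈ geodesicArc p q) :
    rotoreflect x ∈ geodesicArc (rotoreflect p) (rotoreflect q) := by
  obtain ⟨a, b, ha, hb, h⟩ := h
  exact ⟨a, b, ha, hb, by simp [rotoreflect, h]⟩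

/-- The radial projection to the 3-sphere. -/
noncomputable def ofVec (v : E4) (hv : v ≠ 0) : S3 :=
  ⟨‖v‖⁻¹ • v, by
    rw [mem_sphere_zero_iff_norm, norm_smul, norm_inv, norm_norm,
      inv_mul_cancel₀ (norm_ne_zero_iff.mpr hv)]⟩

theorem ofVec_eq_of_smul {v : E4} (hv : v ≠ 0) {e : ℝ} (he : 0 ≤ e) {x : S3}
    (h : x.1 = e • v) : x = ofVec v hv := by
  have h1 : e * ‖v‖ = 1 := by
    have := norm_coe x
    rwa [h, norm_smul, Real.norm_of_nonneg he] at this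
  refine Subtype.ext ?_
  rw [h, eq_inv_of_mul_eq_one_left h1]
  rfl

section geodesicPath

variable {p q : S3} (h : LinearIndependent ℝ ![p.1, q.1])

include h in
theorem segment_ne_zero (t : unitInterval) : (1 - t : ℝ) • p.1 + (t : ℝ) • q.1 ≠ 0 := fun ht => by
  obtain ⟨h1, h2⟩ := LinearIndependent.pair_iff.mp h _ _ ht
  linarith

/-- The geodesic arc between two linearly independent points, parametrised by the radial
projection of the segment between them. -/
noncomputable def geodesicPath : Path p q where
  toFun t := ofVec _ (segment_ne_zero h t)
  continuous_toFun := by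
    have hc : Continuous fun t : unitInterval => (1 - t : ℝ) • p.1 + (t : ℝ) • q.1 := by fun_prop
    exact Continuous.subtype_mk
      ((hc.norm.inv₀ fun t => norm_ne_zero_iff.mpr (segment_ne_zero h t)).smul hc) _
  source' := (ofVec_eq_of_smul (segment_ne_zero h 0) zero_le_one (by simp)).symm
  target' := (ofVec_eq_of_smul (segment_ne_zero h 1) zero_le_one (by simp)).symm

theorem geodesicPath_injective : Function.Injective (geodesicPath h) := by
  intro s t hst
  have hst' := congrArg Subtype.val hst
  simp only [geodesicPath, ofVec, Path.coe_mk_mk] at hst'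
  set m := ‖(1 - s : ℝ) • p.1 + (s : ℝ) • q.1‖⁻¹
  set n := ‖(1 - t : ℝ) • p.1 + (t : ℝ) • q.1‖⁻¹
  have hm : m ≠ 0 := inv_ne_zero (norm_ne_zero_iff.mpr (segment_ne_zero h s))
  obtain ⟨h1, h2⟩ := LinearIndependent.pair_iff.mp h (m * (1 - s) - n * (1 - t)) (m * s - n * t) (by
    refine Eq.trans ?_ (sub_eq_zero.mpr hst')
    module)
  have hmn : m = n := by linarith
  rw [hmn] at h2 hm
  exact Subtype.ext (mul_left_cancel₀ hm (by linarith))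

theorem range_geodesicPath : Set.range (geodesicPath h) = geodesicArc p q := by
  refine Set.Subset.antisymm ?_ ?_
  · rintro _ ⟨t, rfl⟩
    refine ⟨‖(1 - t : ℝ) • p.1 + (t : ℝ) • q.1‖⁻¹ * (1 - t),
      ‖(1 - t : ℝ) • p.1 + (t : ℝ) • q.1‖⁻¹ * t,
      mul_nonneg (by positivity) (by linarith [t.2.2]), mul_nonneg (by positivity) t.2.1, ?_⟩
    rw [mul_smul, mul_smul, ← smul_add]
    rfl
  · rintro x ⟨a, b, ha, hb, hx⟩
    have hab : 0 < a + b := by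
      refine (add_nonneg ha hb).lt_of_ne fun h0 => ?_
      obtain rfl : a = 0 := by linarith
      obtain rfl : b = 0 := by linarith
      simpa [hx] using norm_coe x
    let t : unitInterval := ⟨b / (a + b), by positivity, div_le_one_of_le₀ (by linarith) hab.le⟩
    refine ⟨t, (ofVec_eq_of_smul (segment_ne_zero h t) hab.le ?_).symm⟩
    simp only [t]
    rw [hx, smul_add, smul_smul, smul_smul]
    congr 2 <;> field_simp
    ring

end geodesicPath

/-- The part of the 3-sphere in the cone over a (possibly degenerate) edge `e`; phrased with `Sym2`
so that it does not depend on an orientation of the edge. -/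
def edgeArc {V : Type*} (P : V → S3) (e : Sym2 V) : Set S3 :=
  {x | ∃ a : V →₀ ℝ, 0 ≤ a ∧ (∀ v ∈ a.support, v ∈ e) ∧
    x.1 = Finsupp.linearCombination ℝ (fun v => (P v).1) a}

variable {V : Type*} {G : SimpleGraph V} {P : V → S3}

theorem edgeArc_mk (P : V → S3) (u v : V) : edgeArc P s(u, v) = geodesicArc (P u) (P v) := by
  classical
  refine Set.Subset.antisymm ?_ ?_
  · rintro x ⟨a, ha, hsub, hx⟩
    have hsub' : a.support ⊆ {u, v} := fun w hw => by simpa using hsub w hw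
    rw [Finsupp.linearCombination_apply, Finsupp.sum_of_support_subset a hsub' _ (by simp)] at hx
    obtain rfl | huv := eq_or_ne u v
    · exact ⟨a u, 0, ha u, le_rfl, by simpa using hx⟩
    · exact ⟨a u, a v, ha u, ha v, by rwa [Finset.sum_pair huv] at hx⟩
  · rintro x ⟨a, b, ha, hb, hx⟩
    refine ⟨.single u a + .single v b,
      add_nonneg (Finsupp.single_nonneg.mpr ha) (Finsupp.single_nonneg.mpr hb), fun w hw => ?_,
      by simpa using hx⟩
    simpa using (Finset.union_subset_union Finsupp.support_single_subset
      Finsupp.support_single_subset) (Finsupp.support_add hw)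

end S3

namespace IsConeEmbedding

variable {V : Type*} {G : SimpleGraph V} {P : V → S3}

variable (h : IsConeEmbedding G fun v => (P v).1)

include h

theorem linearIndependent_of_adj {u v : V} (huv : G.Adj u v) :
    LinearIndependent ℝ ![(P u).1, (P v).1] := by
  rw [LinearIndependent.pair_iff]
  exact (LinearIndepOn.pair_iff _ huv.ne).mp (h.linearIndepOn_pair huv)

theorem ne_neg_of_adj {u v : V} (huv : G.Adj u v) : P v ≠ -P u := fun hneg =>
  one_ne_zero (LinearIndependent.pair_iff.mp (h.linearIndependent_of_adj huv) 1 1 (by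
    simp [hneg])).1

theorem mem_of_vert_mem_edgeArc {e : Sym2 V} (he : e ∈ G.edgeSet) {w : V}
    (hw : P w ∈ S3.edgeArc P e) : w ∈ e := by
  obtain ⟨a, ha, hsub, hx⟩ := hw
  have haw : .single w 1 = a := h (single_mem_edgeCone w zero_le_one)
    (mem_edgeCone_of_mem_edgeSet he ha hsub) (by simpa using hx)
  exact hsub w (by simp [← haw])

theorem edgeArc_inter_edgeArc {e e' : Sym2 V} (he : e ∈ G.edgeSet) (he' : e' ∈ G.edgeSet)
    (hne : e ≠ e') : S3.edgeArc P e ∩ S3.edgeArc P e' ⊆ Set.range P := by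
  rintro x ⟨⟨a, ha, hsub, hx⟩, a', ha', hsub', hx'⟩
  obtain rfl : a = a' := h (mem_edgeCone_of_mem_edgeSet he ha hsub)
    (mem_edgeCone_of_mem_edgeSet he' ha' hsub') (hx.symm.trans hx')
  have hsingle : a.support.card ≤ 1 := Finset.card_le_one.mpr fun v hv w hw => by
    by_contra hvw
    exact hne ((Sym2.mem_and_mem_iff hvw).mp ⟨hsub v hv, hsub w hw⟩ |>.trans
      ((Sym2.mem_and_mem_iff hvw).mp ⟨hsub' v hv, hsub' w hw⟩).symm)
  have : Nonempty V := ⟨e.out.1⟩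
  obtain ⟨v, c, rfl⟩ := Finsupp.card_support_le_one'.mp hsingle
  have hc : 0 ≤ c := by simpa using ha v
  have hv : (P v).1 ≠ 0 := h.ne_zero v
  refine ⟨v, ?_⟩
  exact (S3.ofVec_eq_of_smul hv zero_le_one (one_smul ℝ _).symm).trans
    (S3.ofVec_eq_of_smul hv hc (by simpa using hx)).symm

/-- The embedding with great circle arcs as edges. -/
noncomputable def toSpatialEmbedding : SpatialEmbedding G where
  vert := P
  arc e := S3.edgeArc P e.1
  vert_injective u v huv := by
    have := h (single_mem_edgeCone u zero_le_one) (single_mem_edgeCone v zero_le_one)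
      (by simpa using congrArg Subtype.val huv)
    exact Finsupp.single_left_injective one_ne_zero this
  arc_eq_range u v huv := ⟨S3.geodesicPath (h.linearIndependent_of_adj huv),
    S3.geodesicPath_injective _, by rw [S3.range_geodesicPath, S3.edgeArc_mk]⟩
  vert_mem_arc e _ hw := h.mem_of_vert_mem_edgeArc e.2 hw
  arc_inter_arc e e' hne := h.edgeArc_inter_edgeArc e.2 e'.2 fun he => hne (Subtype.ext he)

theorem mem_carrier_iff {x : S3} :
    x ∈ h.toSpatialEmbedding.carrier ↔
      ∃ u v, (u = v ∨ G.Adj u v) ∧ x ∈ S3.geodesicArc (P u) (P v) := by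
  simp only [SpatialEmbedding.carrier, Set.mem_union, Set.mem_iUnion]
  constructor
  · rintro (⟨v, rfl⟩ | ⟨⟨e, he⟩, hx⟩)
    · exact ⟨v, v, Or.inl rfl, 1, 0, by simp [toSpatialEmbedding]⟩
    · induction e using Sym2.ind with
      | _ u v => exact ⟨u, v, Or.inr he, (S3.edgeArc_mk P u v).subset hx⟩
  · rintro ⟨u, v, rfl | huv, hx⟩
    · rw [S3.geodesicArc_self] at hx
      exact Or.inl ⟨u, hx.symm⟩
    · exact Or.inr ⟨⟨s(u, v), huv⟩, (S3.edgeArc_mk P u v).superset hx⟩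

theorem isTame_carrier [Finite V] : S3.IsTame h.toSpatialEmbedding.carrier := by
  classical
  cases nonempty_fintype V
  let s : Finset (V × V) := {p | p.1 = p.2 ∨ G.Adj p.1 p.2}
  refine ⟨Homeomorph.refl S3, s.image fun p => (P p.1, P p.2), fun p hp => ?_, ?_⟩
  · obtain ⟨⟨u, v⟩, huv, rfl⟩ := Finset.mem_image.mp hp
    rcases (Finset.mem_filter.mp huv).2 with huv | huv
    · obtain rfl : u = v := huv
      exact ne_neg_of_mem_unit_sphere ℝ _
    · exact h.ne_neg_of_adj huv
  · ext x
    rw [Finset.set_biUnion_finset_image]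
    simp [mem_carrier_iff, s]

theorem isAchiral_toSpatialEmbedding (f : G →g G) (hf : ∀ v, P (f v) = S3.rotoreflect (P v)) :
    h.toSpatialEmbedding.IsAchiral := by
  refine ⟨S3.quarterTurn, S3.quarterTurn_one_image fun x hx => ?_, S3.quarterTurn_one_image ?_⟩
  · obtain ⟨u, v, huv, hx⟩ := h.mem_carrier_iff.mp hx
    refine h.mem_carrier_iff.mpr ⟨f u, f v, huv.imp (congrArg f) f.map_adj, ?_⟩
    rw [hf, hf]
    exact S3.rotoreflect_mem_geodesicArc hx
  · rintro _ ⟨v, rfl⟩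
    exact ⟨f v, hf v⟩

end IsConeEmbedding

/-- The existence of a placement of the vertices of `G` that embeds the cone over `G` and that the
rotoreflection carries to itself. -/
def HasSymmetricPlacement {V : Type*} (G : SimpleGraph V) : Prop :=
  ∃ (P : V → E4) (f : G →g G), IsConeEmbedding G P ∧ ∀ v, P (f v) = E4.rotoreflect (P v)

theorem HasSymmetricPlacement.of_iso {V W : Type*} {G : SimpleGraph V} {H : SimpleGraph W}
    (h : HasSymmetricPlacement H) (e : G ≃g H) : HasSymmetricPlacement G := by
  obtain ⟨P, f, hP, hf⟩ := h
  exact ⟨P ∘ e, (e.symm.toHom.comp f).comp e.toHom, hP.comp e.toEmbedding, fun v =>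
    (congrArg P (e.apply_symm_apply _)).trans (hf (e v))⟩

theorem HasSymmetricPlacement.achirallyEmbeddable {V : Type*} [Finite V] {G : SimpleGraph V}
    (h : HasSymmetricPlacement G) : G.AchirallyEmbeddable := by
  obtain ⟨P, f, hP, hf⟩ := h
  have hS : IsConeEmbedding G fun v => (S3.ofVec (P v) (hP.ne_zero v)).1 :=
    hP.smul fun v => inv_pos.mpr (norm_pos_iff.mpr (hP.ne_zero v))
  refine ⟨hS.toSpatialEmbedding, hS.isTame_carrier, hS.isAchiral_toSpatialEmbedding f fun v => ?_⟩
  exact Subtype.ext (by simp [S3.ofVec, S3.rotoreflect, hf, E4.norm_rotoreflect])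

/-! ### Generic orbits of the rotoreflection -/

/-- The position of a vertex in a generic orbit of the rotoreflection, which acts by `z ↦ i z`. -/
noncomputable def orbitVec (z : ℂ) : E4 := !₂[(z ^ 2).re, z.re, z.im, 1]

/-- The position of a vertex on the circle fixed by the square of the rotoreflection. -/
noncomputable def axisVec : ℝ × ℝ →ₗ[ℝ] E4 where
  toFun p := !₂[p.1, 0, 0, p.2]
  map_add' p q := by ext i; fin_cases i <;> simp
  map_smul' c p := by ext i; fin_cases i <;> simp

theorem axisVec_apply (p : ℝ × ℝ) : axisVec p = !₂[p.1, 0, 0, p.2] := rfl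

theorem rotoreflect_orbitVec (z : ℂ) :
    E4.rotoreflect (orbitVec z) = orbitVec (Complex.I * z) := by
  ext i
  fin_cases i <;> simp [E4.rotoreflect_apply, orbitVec, mul_pow]

theorem rotoreflect_axisVec (p : ℝ × ℝ) :
    E4.rotoreflect (axisVec p) = axisVec (-p.1, p.2) := by
  ext i
  fin_cases i <;> simp [E4.rotoreflect_apply, axisVec_apply]

theorem axisVec_injective : Function.Injective axisVec := fun p q h =>
  Prod.ext (by simpa [axisVec_apply] using congrArg (fun x : E4 => x 0) h)
    (by simpa [axisVec_apply] using congrArg (fun x : E4 => x 3) h)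

/-- The projection of Euclidean four-space to the plane of the middle coordinates. -/
noncomputable def E4.mid : E4 →ₗ[ℝ] ℂ where
  toFun v := ⟨v 1, v 2⟩
  map_add' v w := by apply Complex.ext <;> simp
  map_smul' c v := by apply Complex.ext <;> simp

theorem E4.mid_apply (v : E4) : E4.mid v = ⟨v 1, v 2⟩ := rfl

theorem mid_orbitVec (z : ℂ) : E4.mid (orbitVec z) = z := by
  simp [E4.mid_apply, orbitVec]

theorem mid_axisVec (p : ℝ × ℝ) : E4.mid (axisVec p) = 0 := by
  apply Complex.ext <;> simp [E4.mid_apply, axisVec_apply]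

/-- The linear form whose kernel is the hyperplane through the points `orbitVec x`, `orbitVec y` and
`orbitVec w`. Restricted to `orbitVec z` with `z` on the unit circle it is, up to the factor
`z² / 2`, the quartic with the roots `x`, `y`, `w` and `(x y w)⁻¹`, expanded in its coefficients. -/
noncomputable def orbitPlane (x y w : ℂ) : E4 →ₗ[ℝ] ℝ where
  toFun v := v 0 - ((x + y + w + (x * y * w)⁻¹) * E4.mid v).re +
    (x * y + x * w + y * w).re * v 3
  map_add' u v := by
    simp only [PiLp.add_apply, map_add, mul_add, Complex.add_re]
    ring
  map_smul' c v := by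
    simp only [PiLp.smul_apply, map_smul, mul_smul_comm, Complex.smul_re, smul_eq_mul,
      RingHom.id_apply]
    ring

theorem orbitPlane_apply (x y w : ℂ) (v : E4) :
    orbitPlane x y w v = v 0 - ((x + y + w + (x * y * w)⁻¹) * E4.mid v).re +
      (x * y + x * w + y * w).re * v 3 := rfl

theorem orbitPlane_axisVec (x y w : ℂ) (p : ℝ × ℝ) :
    orbitPlane x y w (axisVec p) = p.1 + p.2 * (x * y + x * w + y * w).re := by
  rw [orbitPlane_apply, mid_axisVec, mul_zero]
  simp [axisVec_apply, mul_comm]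

theorem add_inv_eq_two_mul_re {u : ℂ} (hu : ‖u‖ = 1) : u + u⁻¹ = 2 * (u.re : ℂ) := by
  rw [Complex.inv_eq_conj hu, Complex.add_conj]
  push_cast
  ring

theorem orbitPlane_orbitVec {x y w z : ℂ} (hx : ‖x‖ = 1) (hy : ‖y‖ = 1) (hw : ‖w‖ = 1)
    (hz : ‖z‖ = 1) :
    2 * (orbitPlane x y w (orbitVec z) : ℂ) =
      z⁻¹ ^ 2 * ((z - x) * (z - y) * (z - w) * (z - (x * y * w)⁻¹)) := by
  have ne_zero : ∀ {u : ℂ}, ‖u‖ = 1 → u ≠ 0 := fun hu => norm_ne_zero_iff.mp (hu ▸ one_ne_zero)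
  have hz2 := add_inv_eq_two_mul_re (u := z ^ 2) (by simp [hz])
  have hxz := add_inv_eq_two_mul_re (u := x * z) (by simp [hx, hz])
  have hyz := add_inv_eq_two_mul_re (u := y * z) (by simp [hy, hz])
  have hwz := add_inv_eq_two_mul_re (u := w * z) (by simp [hw, hz])
  have hxywz := add_inv_eq_two_mul_re (u := (x * y * w)⁻¹ * z) (by simp [hx, hy, hw, hz])
  have hxy := add_inv_eq_two_mul_re (u := x * y) (by simp [hx, hy])
  have hxw := add_inv_eq_two_mul_re (u := x * w) (by simp [hx, hw])
  have hyw := add_inv_eq_two_mul_re (u := y * w) (by simp [hy, hw])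
  have hval : orbitPlane x y w (orbitVec z) = (z ^ 2).re - ((x * z).re + (y * z).re + (w * z).re +
      ((x * y * w)⁻¹ * z).re) + ((x * y).re + (x * w).re + (y * w).re) := by
    simp only [orbitPlane_apply, mid_orbitVec, add_mul, Complex.add_re]
    simp [orbitVec]
  rw [hval]
  push_cast
  calc
    _ = (z ^ 2 + (z ^ 2)⁻¹) - (x * z + (x * z)⁻¹ + (y * z + (y * z)⁻¹) + (w * z + (w * z)⁻¹) +
          ((x * y * w)⁻¹ * z + ((x * y * w)⁻¹ * z)⁻¹)) +
          (x * y + (x * y)⁻¹ + (x * w + (x * w)⁻¹) + (y * w + (y * w)⁻¹)) := by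
      rw [hz2, hxz, hyz, hwz, hxywz, hxy, hxw, hyw]
      ring
    _ = _ := by
      have := ne_zero hx
      have := ne_zero hy
      have := ne_zero hw
      have := ne_zero hz
      field_simp
      ring

/-- The points of the unit circle slightly ahead of a fourth root of unity. -/
def NearFourthRoot (z : ℂ) : Prop :=
  ∃ (k : ℕ) (t : ℝ), 0 < t ∧ t < 1 / 10 ∧ z = Complex.I ^ k * Complex.exp (t * Complex.I)

theorem I_pow_mul_exp_mul (k l : ℕ) (s t : ℝ) :
    Complex.I ^ k * Complex.exp (s * Complex.I) * (Complex.I ^ l * Complex.exp (t * Complex.I)) =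
      Complex.I ^ (k + l) * Complex.exp ((s + t : ℝ) * Complex.I) := by
  push_cast
  rw [pow_add, add_mul, Complex.exp_add]
  ring

theorem abs_re_I_pow_mul_of_even {k : ℕ} (hk : Even k) (u : ℂ) :
    |(Complex.I ^ k * u).re| = |u.re| := by
  obtain ⟨m, rfl⟩ := hk.two_dvd
  rw [pow_mul, Complex.I_sq]
  rcases neg_one_pow_eq_or ℂ m with h | h <;> simp [h]

theorem abs_re_I_pow_mul_of_odd {k : ℕ} (hk : Odd k) (u : ℂ) :
    |(Complex.I ^ k * u).re| = |u.im| := by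
  obtain ⟨m, rfl⟩ := hk
  rw [pow_succ, mul_assoc, abs_re_I_pow_mul_of_even (even_two_mul m)]
  simp

theorem le_abs_re_I_pow_mul_exp {k : ℕ} (hk : Even k) {t : ℝ} (ht : 0 ≤ t) (ht' : t ≤ 1 / 5) :
    49 / 50 ≤ |(Complex.I ^ k * Complex.exp (t * Complex.I)).re| := by
  rw [abs_re_I_pow_mul_of_even hk, Complex.exp_ofReal_mul_I_re]
  refine le_trans ?_ (le_abs_self _)
  nlinarith [Real.one_sub_sq_div_two_le_cos (x := t)]

theorem abs_re_I_pow_mul_exp_le {k : ℕ} (hk : Odd k) {t : ℝ} (ht : 0 ≤ t) (ht' : t ≤ 1 / 5) :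
    |(Complex.I ^ k * Complex.exp (t * Complex.I)).re| ≤ 1 / 5 := by
  rw [abs_re_I_pow_mul_of_odd hk, Complex.exp_ofReal_mul_I_im]
  exact Real.abs_sin_le_abs.trans (by rwa [abs_of_nonneg ht])

namespace NearFourthRoot

theorem norm_eq_one {z : ℂ} (h : NearFourthRoot z) : ‖z‖ = 1 := by
  obtain ⟨k, t, -, -, rfl⟩ := h
  simp [Complex.norm_exp_ofReal_mul_I]

theorem ne_zero {z : ℂ} (h : NearFourthRoot z) : z ≠ 0 :=
  norm_ne_zero_iff.mp (h.norm_eq_one ▸ one_ne_zero)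

/-- The fourth power of the product has a small positive argument. -/
theorem mul_mul_mul_ne_one {x y w z : ℂ} (hx : NearFourthRoot x) (hy : NearFourthRoot y)
    (hw : NearFourthRoot w) (hz : NearFourthRoot z) : x * y * w * z ≠ 1 := by
  obtain ⟨k, r, hr, hr', rfl⟩ := hx
  obtain ⟨l, s, hs, hs', rfl⟩ := hy
  obtain ⟨m, t, ht, ht', rfl⟩ := hw
  obtain ⟨n, u, hu, hu', rfl⟩ := hz
  rw [I_pow_mul_exp_mul, I_pow_mul_exp_mul, I_pow_mul_exp_mul]
  intro h
  have h4 : Complex.exp ((4 * (r + s + t + u) : ℝ) * Complex.I) = 1 := by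
    have := congrArg (· ^ 4) h
    rw [mul_pow, pow_right_comm, Complex.I_pow_four, one_pow, one_mul, one_pow,
      ← Complex.exp_nat_mul] at this
    convert this using 2
    push_cast
    ring
  have hsin : 0 < Real.sin (4 * (r + s + t + u)) :=
    Real.sin_pos_of_pos_of_lt_pi (by linarith) (by linarith [Real.pi_gt_three])
  rw [← Complex.exp_ofReal_mul_I_im, h4, Complex.one_im] at hsin
  exact hsin.false

theorem abs_re_add_le {x y w : ℂ} (hx : NearFourthRoot x) (hy : NearFourthRoot y)
    (hw : NearFourthRoot w) : |(x * y + x * w + y * w).re| ≤ 3 :=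
  (Complex.abs_re_le_norm _).trans ((norm_add₃_le).trans (by
    norm_num [hx.norm_eq_one, hy.norm_eq_one, hw.norm_eq_one]))

/-- Of the three products, either all or exactly one lie near the real axis. -/
theorem le_abs_re_add {x y w : ℂ} (hx : NearFourthRoot x) (hy : NearFourthRoot y)
    (hw : NearFourthRoot w) : 1 / 2 ≤ |(x * y + x * w + y * w).re| := by
  have hle : ∀ {u v : ℂ}, NearFourthRoot u → NearFourthRoot v → |(u * v).re| ≤ 1 :=
    fun {u v} hu hv => by
      simpa [hu.norm_eq_one, hv.norm_eq_one] using Complex.abs_re_le_norm (u * v)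
  have hxy := hle hx hy
  have hxw := hle hx hw
  have hyw := hle hy hw
  obtain ⟨k, r, hr, hr', rfl⟩ := hx
  obtain ⟨l, s, hs, hs', rfl⟩ := hy
  obtain ⟨m, t, ht, ht', rfl⟩ := hw
  simp only [I_pow_mul_exp_mul, Complex.add_re] at *
  have parity : ∀ (n : ℕ) {θ : ℝ}, 0 < θ → θ < 1 / 5 →
      (Even n ∧ 49 / 50 ≤ |(Complex.I ^ n * Complex.exp (θ * Complex.I)).re|) ∨
      (Odd n ∧ |(Complex.I ^ n * Complex.exp (θ * Complex.I)).re| ≤ 1 / 5) := fun n θ h0 h1 =>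
    (Nat.even_or_odd n).imp (fun h => ⟨h, le_abs_re_I_pow_mul_exp h h0.le h1.le⟩)
      fun h => ⟨h, abs_re_I_pow_mul_exp_le h h0.le h1.le⟩
  have h1 := parity (k + l) (add_pos hr hs) (by linarith)
  have h2 := parity (k + m) (add_pos hr ht) (by linarith)
  have h3 := parity (l + m) (add_pos hs ht) (by linarith)
  generalize (_ * _ : ℂ).re = A at *
  generalize (Complex.I ^ (k + m) * _ : ℂ).re = B at *
  generalize (_ * _ : ℂ).re = C at *
  grind

end NearFourthRoot

/-- The points of the plane of the fixed circle that lie on no hyperplane through three points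
`orbitVec x` with `x` near fourth roots of unity, and the origin. -/
def AvoidsOrbitPlanes (p : ℝ × ℝ) : Prop :=
  ∀ r : ℝ, 1 / 2 ≤ |r| → |r| ≤ 3 → p.1 + p.2 * r = 0 → p = 0

theorem avoidsOrbitPlanes_of_fst_le {p : ℝ × ℝ} (h : 5 * |p.1| ≤ |p.2|) : AvoidsOrbitPlanes p := by
  intro r hr _ h0
  have h1 : |p.1| = |p.2| * |r| := by rw [← abs_mul, eq_neg_of_add_eq_zero_left h0, abs_neg]
  have h2 : |p.2| * (1 / 2) ≤ |p.2| * |r| := by gcongr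
  have h3 : |p.2| = 0 := by linarith [abs_nonneg p.2]
  refine Prod.ext (abs_eq_zero.mp ?_) (abs_eq_zero.mp h3)
  rw [h1, h3, zero_mul]

theorem avoidsOrbitPlanes_of_snd_le {p : ℝ × ℝ} (h : 4 * |p.2| ≤ |p.1|) : AvoidsOrbitPlanes p := by
  intro r _ hr h0
  have h1 : |p.1| = |p.2| * |r| := by rw [← abs_mul, eq_neg_of_add_eq_zero_left h0, abs_neg]
  have h2 : |p.2| * |r| ≤ |p.2| * 3 := by gcongr
  have h3 : |p.2| = 0 := by linarith [abs_nonneg p.2]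
  refine Prod.ext (abs_eq_zero.mp ?_) (abs_eq_zero.mp h3)
  rw [h1, h3, zero_mul]

/-- The edges of a graph that is placed in the plane of the fixed circle lie on no hyperplane
through three points `orbitVec x` with `x` near fourth roots of unity. -/
def EdgesAvoidOrbitPlanes {W : Type*} (H : SimpleGraph W) (p : W → ℝ × ℝ) : Prop :=
  ∀ b ∈ edgeCone H, AvoidsOrbitPlanes (Finsupp.linearCombination ℝ p b)

theorem EdgesAvoidOrbitPlanes.avoidsOrbitPlanes {W : Type*} {H : SimpleGraph W} {p : W → ℝ × ℝ}
    (h : EdgesAvoidOrbitPlanes H p) (w : W) : AvoidsOrbitPlanes (p w) := by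
  simpa using h _ (single_mem_edgeCone w zero_le_one)

theorem orbitPlane_orbitVec_eq_zero {x y w : ℂ} (hx : ‖x‖ = 1) (hy : ‖y‖ = 1) (hw : ‖w‖ = 1) :
    ∀ u ∈ ({x, y, w} : Set ℂ), orbitPlane x y w (orbitVec u) = 0 := by
  rintro u (rfl | rfl | rfl)
  · simpa using orbitPlane_orbitVec hx hy hw hx
  · simpa using orbitPlane_orbitVec hx hy hw hy
  · simpa using orbitPlane_orbitVec hx hy hw hw

theorem smul_orbitVec_add_ne_axisVec {x y : ℂ} (hx : NearFourthRoot x) (hy : NearFourthRoot y)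
    {s t : ℝ} (hs : 0 < s) (ht : 0 < t) {q : ℝ × ℝ} (h : y ≠ -x ∨ AvoidsOrbitPlanes q) :
    s • orbitVec x + t • orbitVec y ≠ axisVec q := by
  intro heq
  rcases h with hne | hq
  · have hmid : s • x + t • y = 0 := by
      simpa only [map_add, map_smul, mid_orbitVec, mid_axisVec] using congrArg E4.mid heq
    have hst : s = t := by
      simpa [norm_smul, hx.norm_eq_one, hy.norm_eq_one, abs_of_pos, hs, ht] using
        congrArg norm (eq_neg_of_add_eq_zero_left hmid)
    rw [hst, ← smul_add, smul_eq_zero, add_comm] at hmid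
    exact hne (eq_neg_of_add_eq_zero_left (hmid.resolve_left ht.ne'))
  · have hzero := orbitPlane_orbitVec_eq_zero hx.norm_eq_one hy.norm_eq_one hx.norm_eq_one
    have hplane := congrArg (orbitPlane x y x) heq
    rw [map_add, map_smul, map_smul, hzero x (by simp), hzero y (by simp), orbitPlane_axisVec,
      smul_zero, smul_zero, add_zero] at hplane
    rw [hq _ (NearFourthRoot.le_abs_re_add hx hy hx) (NearFourthRoot.abs_re_add_le hx hy hx)
      hplane.symm, map_zero] at heq
    have hlast : s + t = 0 := by simpa [orbitVec] using congrArg (fun v : E4 => v 3) heq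
    linarith

section Placement

variable {O W : Type*} {z : O → ℂ} {p : W → ℝ × ℝ}

/-- The placement of a graph whose vertices either run through generic orbits of the rotoreflection
(`O`) or lie on the circle fixed by its square (`W`). -/
noncomputable def placement (z : O → ℂ) (p : W → ℝ × ℝ) : O ⊕ W → E4 :=
  Sum.elim (fun v => orbitVec (z v)) fun w => axisVec (p w)

theorem placement_inl_ne_zero (v : O) : placement z p (.inl v) ≠ 0 := fun h => by
  simpa [placement, orbitVec] using congrArg (fun x : E4 => x 3) h

variable (hz : ∀ v, NearFourthRoot (z v)) (hz' : Function.Injective z)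
  (hp : ∀ w, AvoidsOrbitPlanes (p w)) (hp' : ∀ w, p w ≠ 0)

include hz hz' hp hp'

theorem mem_of_orbitPlane_eq_zero {x y w : O} {i : O ⊕ W}
    (h : orbitPlane (z x) (z y) (z w) (placement z p i) = 0) :
    i ∈ ({.inl x, .inl y, .inl w} : Set (O ⊕ W)) := by
  rcases i with v | i
  · have hroots := orbitPlane_orbitVec (hz x).norm_eq_one (hz y).norm_eq_one (hz w).norm_eq_one
      (hz v).norm_eq_one
    have hlast : z v - (z x * z y * z w)⁻¹ ≠ 0 := fun h0 =>
      NearFourthRoot.mul_mul_mul_ne_one (hz x) (hz y) (hz w) (hz v) (by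
        rw [sub_eq_zero.mp h0, mul_inv_cancel₀
          (mul_ne_zero (mul_ne_zero (hz x).ne_zero (hz y).ne_zero) (hz w).ne_zero)])
    rw [show orbitPlane (z x) (z y) (z w) (orbitVec (z v)) = 0 from h] at hroots
    simpa [hlast, (hz v).ne_zero, sub_eq_zero, hz'.eq_iff, or_assoc, -mul_inv_rev] using hroots
  · rw [show placement z p (.inr i) = axisVec (p i) from rfl, orbitPlane_axisVec] at h
    exact (hp' i (hp i _ (NearFourthRoot.le_abs_re_add (hz x) (hz y) (hz w))
      (NearFourthRoot.abs_re_add_le (hz x) (hz y) (hz w)) h)).elim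

theorem mem_of_placement_mem_span {x y w : O} {i : O ⊕ W}
    (h : placement z p i ∈ Submodule.span ℝ (placement z p '' {.inl x, .inl y, .inl w})) :
    i ∈ ({.inl x, .inl y, .inl w} : Set (O ⊕ W)) := by
  refine mem_of_orbitPlane_eq_zero hz hz' hp hp' (LinearMap.mem_ker.mp ?_)
  refine Submodule.span_le.mpr ?_ h
  have hzero := orbitPlane_orbitVec_eq_zero (hz x).norm_eq_one (hz y).norm_eq_one
    (hz w).norm_eq_one
  rintro _ ⟨j, rfl | rfl | rfl, rfl⟩ <;> exact hzero _ (by simp)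

theorem linearIndepOn_placement (x y w : O) (i : O ⊕ W) :
    LinearIndepOn ℝ (placement z p) {i, .inl x, .inl y, .inl w} := by
  have hspan : ∀ (x y w : O) (i : O ⊕ W),
      placement z p i ∈ Submodule.span ℝ (placement z p '' {.inl x, .inl y, .inl w}) →
        i ∈ ({.inl x, .inl y, .inl w} : Set (O ⊕ W)) :=
    fun _ _ _ _ => mem_of_placement_mem_span hz hz' hp hp'
  refine linearIndepOn_insert_iff.mpr ⟨?_, hspan x y w i⟩
  refine linearIndepOn_insert_iff.mpr ⟨?_, fun h => ?_⟩
  · refine linearIndepOn_insert_iff.mpr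
      ⟨(linearIndepOn_singleton_iff ℝ).mpr (placement_inl_ne_zero w), fun h => ?_⟩
    simpa using hspan w w w (.inl y) (by simpa using h)
  · simpa using hspan y y w (.inl x) (by simpa using h)

end Placement

section PlacementCone

variable {O W : Type*} {G : SimpleGraph (O ⊕ W)} {z : O → ℂ} {p : W → ℝ × ℝ}

theorem linearCombination_placement (a : O →₀ ℝ) (b : W →₀ ℝ) :
    Finsupp.linearCombination ℝ (placement z p) (a.sumElim b) =
      Finsupp.linearCombination ℝ (fun v => orbitVec (z v)) a +
        axisVec (Finsupp.linearCombination ℝ p b) := by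
  rw [Finsupp.apply_linearCombination, Finsupp.linearCombination_apply, Finsupp.sum_sumElim]
  rfl

theorem mid_linearCombination_placement (a : O →₀ ℝ) (b : W →₀ ℝ) :
    E4.mid (Finsupp.linearCombination ℝ (placement z p) (a.sumElim b)) =
      Finsupp.linearCombination ℝ z a := by
  rw [linearCombination_placement, map_add, mid_axisVec, add_zero, Finsupp.apply_linearCombination]
  simp only [Function.comp_def, mid_orbitVec]

theorem exists_support_subset_pair {V : Type*} {s : Finset V} (hs : s.card ≤ 2) {x : V}
    (hx : x ∈ s) : ∃ i, (s : Set V) ⊆ {i, x} := by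
  classical
  have : Nonempty V := ⟨x⟩
  obtain ⟨i, hi⟩ := (Finset.card_le_one_iff_subset_singleton (s := s.erase x)).mp (by
    rw [Finset.card_erase_of_mem hx]
    omega)
  refine ⟨i, fun v hv => ?_⟩
  obtain rfl | hvx := eq_or_ne v x
  · simp
  · simpa [hvx] using hi (Finset.mem_erase.mpr ⟨hvx, hv⟩)

/-- The condition under which no edge between two vertices of generic orbits crosses an edge of
the fixed circle: either the former never pass over the plane of the circle, or the latter stay off
the hyperplanes that contain the former. -/
def AxisEdgesDisjoint (G : SimpleGraph (O ⊕ W)) (z : O → ℂ) (p : W → ℝ × ℝ) : Prop :=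
  (∀ u v, G.Adj (.inl u) (.inl v) → z v ≠ -z u) ∨ EdgesAvoidOrbitPlanes (G.comap Sum.inr) p

theorem inr_mem_edgeCone {a : O →₀ ℝ} {b : W →₀ ℝ} (h : a.sumElim b ∈ edgeCone G) :
    b ∈ edgeCone (G.comap Sum.inr) := by
  obtain ⟨h0, hcard, hclique⟩ := h
  refine ⟨fun w => h0 (.inr w), le_trans ?_ hcard, fun v hv w hw hvw => ?_⟩
  · exact Finset.card_le_card_of_injOn Sum.inr (fun w hw => by simpa using hw)
      Sum.inr_injective.injOn
  · exact hclique (by simpa using hv) (by simpa using hw) (Sum.inr_injective.ne hvw)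

theorem eq_of_card_support_le_one (hz : ∀ v, NearFourthRoot (z v)) (hz' : Function.Injective z)
    {a b : O →₀ ℝ} (ha : 0 ≤ a) (hb : 0 ≤ b) (ha' : a.support.card ≤ 1) (hb' : b.support.card ≤ 1)
    (h : Finsupp.linearCombination ℝ z a = Finsupp.linearCombination ℝ z b) : a = b := by
  cases isEmpty_or_nonempty O
  · exact Subsingleton.elim a b
  obtain ⟨u, s, rfl⟩ := Finsupp.card_support_le_one'.mp ha'
  obtain ⟨v, t, rfl⟩ := Finsupp.card_support_le_one'.mp hb'
  rw [Finsupp.single_nonneg] at ha hb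
  rw [Finsupp.linearCombination_single, Finsupp.linearCombination_single] at h
  obtain rfl : s = t := by
    simpa [norm_smul, (hz _).norm_eq_one, abs_of_nonneg, ha, hb] using congrArg norm h
  obtain rfl | hs := eq_or_ne s 0
  · simp
  · rw [hz' (smul_right_injective ℂ hs h)]

variable (hz : ∀ v, NearFourthRoot (z v)) (hz' : Function.Injective z)
  (hp : IsConeEmbedding (G.comap Sum.inr) p) (hp' : ∀ w, AvoidsOrbitPlanes (p w))
  (hdisj : AxisEdgesDisjoint G z p)

include hz in
theorem linearCombination_placement_ne_axisVec {a : O ⊕ W →₀ ℝ} (ha : a ∈ edgeCone G) {u v : O}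
    (huv : u ≠ v) (hsupp : (a.support : Set (O ⊕ W)) = {.inl u, .inl v}) {b : W →₀ ℝ}
    (hb : b ∈ edgeCone (G.comap Sum.inr)) (hdisj : AxisEdgesDisjoint G z p) :
    Finsupp.linearCombination ℝ (placement z p) a ≠
      axisVec (Finsupp.linearCombination ℝ p b) := by
  classical
  have hsupp' : a.support = {.inl u, .inl v} := by exact_mod_cast hsupp
  have huv' : (.inl u : O ⊕ W) ≠ .inl v := Sum.inl_injective.ne huv
  have hu : .inl u ∈ a.support := by simp [hsupp']
  have hv : .inl v ∈ a.support := by simp [hsupp']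
  have hpos : ∀ i ∈ a.support, 0 < a i := fun i hi =>
    (ha.1 i).lt_of_ne' (Finsupp.mem_support_iff.mp hi)
  rw [Finsupp.linearCombination_apply, Finsupp.sum, hsupp', Finset.sum_pair huv']
  exact smul_orbitVec_add_ne_axisVec (hz u) (hz v) (hpos _ hu) (hpos _ hv)
    (hdisj.imp (fun h => h u v (ha.2.2 hu hv huv')) fun h => h b hb)

include hz hz' hp hp' hdisj in
theorem eq_of_inl_mem_support {a a' : O ⊕ W →₀ ℝ} (ha : a ∈ edgeCone G) (ha' : a' ∈ edgeCone G)
    (h : Finsupp.linearCombination ℝ (placement z p) a =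
      Finsupp.linearCombination ℝ (placement z p) a')
    {u v : O} (huv : u ≠ v) (hu : .inl u ∈ a.support) (hv : .inl v ∈ a.support) : a = a' := by
  have hsupp : (a.support : Set (O ⊕ W)) = {.inl u, .inl v} := by
    obtain ⟨i, hi⟩ := exists_support_subset_pair ha.2.1 hv
    obtain rfl : .inl u = i := by simpa [huv] using hi hu
    exact hi.antisymm (by rintro _ (rfl | rfl) <;> assumption)
  obtain ⟨x, hx⟩ : ∃ x, .inl x ∈ a'.support := by
    by_contra! hnone
    obtain ⟨a₁, b, rfl⟩ : ∃ (a₁ : O →₀ ℝ) (b : W →₀ ℝ), a' = a₁.sumElim b :=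
      ⟨_, _, (Finsupp.comapDomain_sumElim_comapDomain ..).symm⟩
    obtain rfl : a₁ = 0 := by ext x; simpa using hnone x
    refine linearCombination_placement_ne_axisVec hz ha huv hsupp (inr_mem_edgeCone ha') hdisj ?_
    rw [h, linearCombination_placement, map_zero, zero_add]
  obtain ⟨i, hi⟩ := exists_support_subset_pair ha'.2.1 hx
  refine linearIndepOn_iffₛ.mp (linearIndepOn_placement hz hz' hp' hp.ne_zero x u v i) a ?_ a' ?_ h
  · rw [Finsupp.mem_supported, hsupp]
    exact fun j hj => Or.inr (Or.inr hj)
  · rw [Finsupp.mem_supported]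
    exact hi.trans (by rintro j (rfl | rfl) <;> simp)

include hz hz' hp hp' hdisj in
theorem isConeEmbedding_placement : IsConeEmbedding G (placement z p) := by
  intro a ha a' ha' h
  obtain ⟨a₁, b, rfl⟩ : ∃ (a₁ : O →₀ ℝ) (b : W →₀ ℝ), a = a₁.sumElim b :=
    ⟨_, _, (Finsupp.comapDomain_sumElim_comapDomain ..).symm⟩
  obtain ⟨a₁', b', rfl⟩ : ∃ (a₁' : O →₀ ℝ) (b' : W →₀ ℝ), a' = a₁'.sumElim b' :=
    ⟨_, _, (Finsupp.comapDomain_sumElim_comapDomain ..).symm⟩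
  obtain hcard | hcard := Nat.lt_or_ge 1 a₁.support.card
  · obtain ⟨u, hu, v, hv, huv⟩ := Finset.one_lt_card.mp hcard
    exact eq_of_inl_mem_support hz hz' hp hp' hdisj ha ha' h huv (by simpa using hu)
      (by simpa using hv)
  obtain hcard' | hcard' := Nat.lt_or_ge 1 a₁'.support.card
  · obtain ⟨u, hu, v, hv, huv⟩ := Finset.one_lt_card.mp hcard'
    exact (eq_of_inl_mem_support hz hz' hp hp' hdisj ha' ha h.symm huv (by simpa using hu)
      (by simpa using hv)).symm
  obtain rfl : a₁ = a₁' := eq_of_card_support_le_one hz hz' (fun v => ha.1 (.inl v))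
    (fun v => ha'.1 (.inl v)) hcard hcard' (by
      simpa only [mid_linearCombination_placement] using congrArg E4.mid h)
  rw [linearCombination_placement, linearCombination_placement, add_right_inj] at h
  rw [hp (inr_mem_edgeCone ha) (inr_mem_edgeCone ha') (axisVec_injective h)]

end PlacementCone

theorem pow_val_add {M : Type*} [Monoid M] {x : M} (hx : x ^ 4 = 1) (k l : Fin 4) :
    x ^ ((k + l : Fin 4) : ℕ) = x ^ (k : ℕ) * x ^ (l : ℕ) := by
  rw [Fin.val_add, ← pow_eq_pow_mod _ hx, pow_add]

/-- The points of the orbit of `exp (t i)` under multiplication by `i`. -/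
noncomputable def orbitPoint (t : ℝ) (k : Fin 4) : ℂ :=
  Complex.I ^ (k : ℕ) * Complex.exp (t * Complex.I)

theorem nearFourthRoot_orbitPoint {t : ℝ} (ht : t ∈ Set.Ioo 0 (1 / 10)) (k : Fin 4) :
    NearFourthRoot (orbitPoint t k) := ⟨k, t, ht.1, ht.2, rfl⟩

theorem orbitPoint_add_one (t : ℝ) (k : Fin 4) :
    orbitPoint t (k + 1) = Complex.I * orbitPoint t k := by
  rw [orbitPoint, orbitPoint, pow_val_add Complex.I_pow_four, Fin.val_one, pow_one]
  ring

theorem orbitPoint_add_two (t : ℝ) (k : Fin 4) : orbitPoint t (k + 2) = -orbitPoint t k := by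
  rw [orbitPoint, orbitPoint, pow_val_add Complex.I_pow_four, Fin.val_two, Complex.I_sq]
  ring

theorem orbitPoint_pow_four (t : ℝ) (k : Fin 4) :
    orbitPoint t k ^ 4 = Complex.exp ((4 * t : ℝ) * Complex.I) := by
  rw [orbitPoint, mul_pow, pow_right_comm, Complex.I_pow_four, one_pow, one_mul,
    ← Complex.exp_nat_mul]
  push_cast
  ring_nf

theorem orbitPoint_eq_iff {s t : ℝ} (hs : s ∈ Set.Ioo 0 (1 / 10)) (ht : t ∈ Set.Ioo 0 (1 / 10))
    {k l : Fin 4} : orbitPoint s k = orbitPoint t l ↔ s = t ∧ k = l := by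
  refine ⟨fun h => ?_, fun ⟨h, h'⟩ => h ▸ h' ▸ rfl⟩
  have hcos : Real.cos (4 * s) = Real.cos (4 * t) := by
    rw [← Complex.exp_ofReal_mul_I_re, ← Complex.exp_ofReal_mul_I_re, ← orbitPoint_pow_four s k,
      h, orbitPoint_pow_four]
  have hmem : ∀ r ∈ Set.Ioo (0 : ℝ) (1 / 10), 4 * r ∈ Set.Icc 0 Real.pi := fun r hr =>
    ⟨by linarith [hr.1], by linarith [hr.2, Real.pi_gt_three]⟩
  obtain rfl : s = t := mul_left_cancel₀ four_ne_zero (Real.injOn_cos (hmem s hs) (hmem t ht) hcos)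
  exact ⟨rfl, Fin.ext (Complex.isPrimitiveRoot_I.pow_inj k.2 l.2
    (mul_right_cancel₀ (Complex.exp_ne_zero _) h))⟩

theorem exists_injective_forall_mem (J : Type*) [Finite J] {α : Type*} {s : Set α}
    (hs : s.Infinite) : ∃ t : J → α, Function.Injective t ∧ ∀ j, t j ∈ s := by
  cases nonempty_fintype J
  have e := (Fintype.equivFin J).toEmbedding.trans (Fin.valEmbedding.trans hs.natEmbedding)
  exact ⟨fun j => e j, Subtype.val_injective.comp e.injective, fun j => (e j).2⟩

theorem hasSymmetricPlacement_of_orbits {J W : Type*} [Finite J]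
    {G : SimpleGraph ((J × Fin 4) ⊕ W)} {p : W → ℝ × ℝ} {σ : W → W}
    (hp : IsConeEmbedding (G.comap Sum.inr) p) (hp' : ∀ w, AvoidsOrbitPlanes (p w))
    (hdisj : (∀ j k, ¬ G.Adj (.inl (j, k)) (.inl (j, k + 2))) ∨
      EdgesAvoidOrbitPlanes (G.comap Sum.inr) p)
    (hσ : ∀ w, p (σ w) = (-(p w).1, (p w).2))
    (hadj : ∀ u v, G.Adj u v →
      G.Adj (Sum.map (Prod.map id (· + 1)) σ u) (Sum.map (Prod.map id (· + 1)) σ v)) :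
    HasSymmetricPlacement G := by
  obtain ⟨t, ht, hmem⟩ := exists_injective_forall_mem J (Set.Ioo_infinite (a := (0 : ℝ))
    (b := 1 / 10) (by norm_num))
  have heq : ∀ {i j k l}, orbitPoint (t i) k = orbitPoint (t j) l ↔ i = j ∧ k = l :=
    fun {i j k l} => (orbitPoint_eq_iff (hmem i) (hmem j)).trans (and_congr_left' ht.eq_iff)
  refine ⟨placement (fun x : J × Fin 4 => orbitPoint (t x.1) x.2) p, ⟨_, hadj _ _⟩,
    isConeEmbedding_placement (fun x => nearFourthRoot_orbitPoint (hmem x.1) x.2)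
      (fun x y h => Prod.ext_iff.mpr (heq.mp h)) hp hp' (hdisj.imp_left ?_), ?_⟩
  · rintro hG ⟨i, k⟩ ⟨j, l⟩ h heq'
    obtain ⟨rfl, rfl⟩ : j = i ∧ l = k + 2 := heq.mp (heq'.trans (orbitPoint_add_two _ _).symm)
    exact hG j k h
  · rintro (⟨j, k⟩ | w)
    · exact (congrArg orbitVec (orbitPoint_add_one _ _)).trans (rotoreflect_orbitVec _).symm
    · exact (congrArg axisVec (hσ w)).trans (rotoreflect_axisVec _).symm

/-! ### Colour classes and orbits -/

section Colouring

open scoped Finset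

variable {V W K L : Type*}

theorem completeMultipartite_eq_comap {k : ℕ} (m : Fin k → ℕ) :
    completeMultipartite m = (⊤ : SimpleGraph (Fin k)).comap Sigma.fst := by
  ext x y
  simp

theorem comap_top_join (f : V → K) (g : W → L) :
    ((⊤ : SimpleGraph K).comap f).join ((⊤ : SimpleGraph L).comap g) =
      (⊤ : SimpleGraph (K ⊕ L)).comap (Sum.map f g) := by
  ext x y
  rcases x with x | x <;> rcases y with y | y <;> simp [SimpleGraph.join]

theorem comap_top_joinCopies (n : ℕ) (f : V → K) :
    ((⊤ : SimpleGraph K).comap f).joinCopies n =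
      (⊤ : SimpleGraph (Fin n × K)).comap (Prod.map id f) := by
  ext x y
  simp [SimpleGraph.joinCopies, Prod.ext_iff, imp_iff_not_or]

theorem comap_top_comp (f : V → K) {g : K → L} (hg : Function.Injective g) :
    (⊤ : SimpleGraph L).comap (g ∘ f) = (⊤ : SimpleGraph K).comap f := by
  ext x y
  simp [hg.eq_iff]

theorem nonempty_iso_comap_top [Fintype V] [Fintype W] [DecidableEq K] (f : V → K) (g : W → K)
    (h : ∀ κ, #{v | f v = κ} = #{w | g w = κ}) :
    Nonempty ((⊤ : SimpleGraph K).comap f ≃g (⊤ : SimpleGraph K).comap g) := by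
  have e : ∀ κ, Nonempty ({v // f v = κ} ≃ {w // g w = κ}) := fun κ => by
    rw [← Fintype.card_eq, Fintype.card_subtype, Fintype.card_subtype]
    exact h κ
  let E : V ≃ W := (Equiv.sigmaFiberEquiv f).symm.trans
    ((Equiv.sigmaCongrRight fun κ => (e κ).some).trans (Equiv.sigmaFiberEquiv g))
  have hE : ∀ v, g (E v) = f v := fun v => ((e (f v)).some ⟨v, rfl⟩).2
  exact ⟨⟨E, by simp [hE]⟩⟩

/-- The sizes `n` of the colour classes are those of a union of free orbits of a symmetry of order
four that acts on the colours by `π`; `m κ` is the number of orbits that start in the colour `κ`. -/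
def IsOrbitSum [Fintype K] [DecidableEq K] (π : Equiv.Perm K) (n : K → ℕ) : Prop :=
  ∃ m : K → ℕ, ∀ κ, n κ = ∑ κ', m κ' * #{k : Fin 4 | (π ^ (k : ℕ)) κ' = κ}

/-- A placement `p` on the fixed circle of vertices with the colours `ω` that is symmetric under the
rotoreflection, which acts on the colours by `π`. -/
structure IsCirclePart (π : Equiv.Perm K) (ω : W → K) (p : W → ℝ × ℝ) : Prop where
  isConeEmbedding : IsConeEmbedding ((⊤ : SimpleGraph K).comap ω) p
  avoidsOrbitPlanes : ∀ w, AvoidsOrbitPlanes (p w)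
  exists_reflection : ∀ w, ∃ w', p w' = (-(p w).1, (p w).2) ∧ ω w' = π (ω w)

theorem IsCirclePart.inr {π : Equiv.Perm K} {ω : W → K} {p : W → ℝ × ℝ}
    (h : IsCirclePart π ω p) (ρ : Equiv.Perm L) :
    IsCirclePart (ρ.sumCongr π) (fun w => Sum.inr (ω w)) p where
  isConeEmbedding := by
    have := h.isConeEmbedding
    rwa [← comap_top_comp ω (Sum.inr_injective (α := L))] at this
  avoidsOrbitPlanes := h.avoidsOrbitPlanes
  exists_reflection w := (h.exists_reflection w).imp fun _ h => ⟨h.1, congrArg Sum.inr h.2⟩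

namespace IsOrbitSum

variable [Fintype K] [DecidableEq K] [Fintype L] [DecidableEq L]
variable {π : Equiv.Perm K} {ρ : Equiv.Perm L} {n : K → ℕ} {n' : L → ℕ}

theorem sumElim (h : IsOrbitSum π n) (h' : IsOrbitSum ρ n') :
    IsOrbitSum (π.sumCongr ρ) (Sum.elim n n') := by
  obtain ⟨m, hm⟩ := h
  obtain ⟨m', hm'⟩ := h'
  have hpow : ∀ k : ℕ, π.sumCongr ρ ^ k = (π ^ k).sumCongr (ρ ^ k) := fun k =>
    (map_pow (Equiv.Perm.sumCongrHom K L) (π, ρ) k).symm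
  refine ⟨Sum.elim m m', ?_⟩
  rintro (κ | κ)
  · simp [hm, hpow, Fintype.sum_sum_type]
  · simp [hm', hpow, Fintype.sum_sum_type]

theorem prod (h : IsOrbitSum π n) (c : L → ℕ) :
    IsOrbitSum (π.prodCongr (1 : Equiv.Perm L)) fun κ => c κ.2 * n κ.1 := by
  obtain ⟨m, hm⟩ := h
  have hpow : ∀ k : ℕ, π.prodCongr (1 : Equiv.Perm L) ^ k = (π ^ k).prodCongr 1 := fun k => by
    induction k with
    | zero => rfl
    | succ k ih => rw [pow_succ, ih, pow_succ]; rfl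
  refine ⟨fun κ => c κ.2 * m κ.1, fun κ => ?_⟩
  simp only [hm, Finset.mul_sum, Fintype.sum_prod_type]
  refine Finset.sum_congr rfl fun κ' _ => ?_
  rw [Finset.sum_eq_single κ.2]
  · simp [hpow, Prod.ext_iff, mul_assoc]
  · intro i _ hi
    simp [hpow, Prod.ext_iff, hi]
  · simp

theorem one (h : ∀ κ, 4 ∣ n κ) : IsOrbitSum 1 n := by
  choose m hm using h
  refine ⟨m, fun κ => ?_⟩
  rw [Finset.sum_eq_single κ (fun κ' _ hκ => by simp [hκ]) (by simp)]
  simp [hm, mul_comm]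

end IsOrbitSum

theorem isOrbitSum_addRight_four : IsOrbitSum (Equiv.addRight (1 : Fin 4)) fun _ => 1 :=
  ⟨![1, 0, 0, 0], by decide⟩

theorem isOrbitSum_addRight_two : IsOrbitSum (Equiv.addRight (1 : Fin 2)) fun _ => 2 :=
  ⟨![1, 0], by decide⟩

theorem isOrbitSum_one_fin_three (l m : ℕ) :
    IsOrbitSum (1 : Equiv.Perm (Fin 3)) ![4 * l, 4 * m, 0] :=
  .one fun κ => by fin_cases κ <;> simp

theorem isOrbitSum_swap (l m : ℕ) :
    IsOrbitSum (Equiv.swap (0 : Fin 3) 1) ![2 * l, 2 * l, 4 * m] := by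
  have hcard : ∀ κ' κ, #{k : Fin 4 | (Equiv.swap (0 : Fin 3) 1 ^ (k : ℕ)) κ' = κ} =
      ![![2, 2, 0], ![2, 2, 0], ![0, 0, 4]] κ' κ := by decide
  refine ⟨![l, 0, m], fun κ => ?_⟩
  fin_cases κ <;> simp [hcard, Fin.sum_univ_three, mul_comm]

theorem hasSymmetricPlacement_comap_top_of_orbits {J : Type*} [Finite J] {π : Equiv.Perm K}
    (hπ : π ^ 4 = 1) {f : J → K} {ω : W → K} {p : W → ℝ × ℝ} (hp : IsCirclePart π ω p)
    (hdisj : (∀ j, π (π (f j)) = f j) ∨ EdgesAvoidOrbitPlanes ((⊤ : SimpleGraph K).comap ω) p) :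
    HasSymmetricPlacement ((⊤ : SimpleGraph K).comap
      (Sum.elim (fun x : J × Fin 4 => (π ^ (x.2 : ℕ)) (f x.1)) ω)) := by
  choose σ hσ hω using hp.exists_reflection
  refine hasSymmetricPlacement_of_orbits hp.isConeEmbedding hp.avoidsOrbitPlanes
    (hdisj.imp_left fun h j k => ?_) hσ ?_
  · simp [pow_val_add hπ, pow_two, h]
  · have hcolour : ∀ u, Sum.elim (fun x : J × Fin 4 => (π ^ (x.2 : ℕ)) (f x.1)) ω
        (Sum.map (Prod.map id (· + 1)) σ u) =
        π (Sum.elim (fun x : J × Fin 4 => (π ^ (x.2 : ℕ)) (f x.1)) ω u) := by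
      rintro (⟨j, k⟩ | w)
      · simp [add_comm k, pow_val_add hπ]
      · exact hω w
    intro u v huv
    simpa [hcolour] using huv

theorem hasSymmetricPlacement_comap_top [Fintype V] [Fintype W] [Fintype K] [DecidableEq K]
    {c : V → K} {π : Equiv.Perm K} (hπ : π ^ 4 = 1) {n : K → ℕ} (hn : IsOrbitSum π n)
    {ω : W → K} {p : W → ℝ × ℝ} (hp : IsCirclePart π ω p)
    (hc : ∀ κ, #{v | c v = κ} = n κ + #{w | ω w = κ})
    (hdisj : (∀ κ, n κ ≠ 0 → π (π κ) = κ) ∨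
      EdgesAvoidOrbitPlanes ((⊤ : SimpleGraph K).comap ω) p) :
    HasSymmetricPlacement ((⊤ : SimpleGraph K).comap c) := by
  obtain ⟨m, hm⟩ := hn
  obtain ⟨e⟩ := nonempty_iso_comap_top c
    (Sum.elim (fun x : (Σ κ, Fin (m κ)) × Fin 4 => (π ^ (x.2 : ℕ)) x.1.1) ω) fun κ => by
      simp only [hc, hm, Finset.card_filter, Fintype.sum_sum_type, Fintype.sum_prod_type,
        Fintype.sum_sigma, Sum.elim_inl, Sum.elim_inr]
      exact congrArg (· + _) (Finset.sum_congr rfl fun κ' _ => (Fin.sum_const (m κ') _).symm)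
  refine (hasSymmetricPlacement_comap_top_of_orbits hπ (f := Sigma.fst) hp
    (hdisj.imp_left fun h j => h _ (ne_of_gt ?_))).of_iso e
  rw [hm]
  refine Finset.sum_pos' (fun _ _ => Nat.zero_le _) ⟨j.1, Finset.mem_univ _, ?_⟩
  exact Nat.mul_pos j.2.pos (Finset.card_pos.mpr ⟨0, by simp⟩)

theorem card_filter_sumMap [Fintype V] [Fintype W] [DecidableEq K] [DecidableEq L] (f : V → K)
    (g : W → L) (κ : K ⊕ L) : #{x | Sum.map f g x = κ} =
      Sum.elim (fun k => #{v | f v = k}) (fun l => #{w | g w = l}) κ := by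
  rcases κ with κ | κ <;> simp [Finset.card_filter, -Finset.sum_boole]

theorem card_filter_prodMap_id [Fintype V] [DecidableEq K] {n : ℕ} (f : V → K)
    (κ : Fin n × K) : #{x | Prod.map id f x = κ} = #{v | f v = κ.2} := by
  have hprod : #{x | Prod.map id f x = κ} = #({κ.1} ×ˢ ({v | f v = κ.2} : Finset V)) :=
    congrArg _ (by ext x; simp [Prod.ext_iff, and_comm, eq_comm])
  rw [hprod, Finset.card_product, Finset.card_singleton, one_mul]

theorem card_filter_sigma_fst {k : ℕ} (m : Fin k → ℕ) (i : Fin k) :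
    #{x : Σ i, Fin (m i) | x.1 = i} = m i := by
  rw [← Fintype.card_subtype, Fintype.card_congr (Equiv.sigmaSubtype i), Fintype.card_fin]

theorem achirallyEmbeddable_of_isCirclePart {γ : SimpleGraph V} {k₁ k₂ k₃ : ℕ}
    {a : Fin k₁ → ℕ} {b : Fin k₂ → ℕ} {c : Fin k₃ → ℕ} {q : Fin 3 → ℕ}
    (hγ : Nonempty (γ ≃g
      ((((completeMultipartite a).joinCopies 4).join ((completeMultipartite b).joinCopies 2)).join
        (completeMultipartite c)).join (completeMultipartite q)))
    (hb : ∀ i, Even (b i)) (hc : ∀ i, 4 ∣ c i) (σ : Equiv.Perm (Fin 3)) {τ : Equiv.Perm (Fin 3)}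
    (hτ : ∀ i, τ (τ i) = i) {o : Fin 3 → ℕ} (ho : IsOrbitSum τ o) [Fintype W] {ω : W → Fin 3}
    {p : W → ℝ × ℝ} (hp : IsCirclePart τ ω p) (hq : ∀ i, q (σ i) = o i + #{w | ω w = i})
    (ha : (∀ i, a i = 0) ∨ EdgesAvoidOrbitPlanes ((⊤ : SimpleGraph (Fin 3)).comap ω) p) :
    γ.AchirallyEmbeddable := by
  obtain ⟨e⟩ := hγ
  have : Finite V := .of_equiv _ e.toEquiv.symm
  choose b' hb' using fun i => (hb i).two_dvd
  have hq' : completeMultipartite q = (⊤ : SimpleGraph (Fin 3)).comap (σ.symm ∘ Sigma.fst) := by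
    rw [comap_top_comp _ σ.symm.injective, completeMultipartite_eq_comap]
  rw [hq', completeMultipartite_eq_comap, completeMultipartite_eq_comap,
    completeMultipartite_eq_comap, comap_top_joinCopies, comap_top_joinCopies, comap_top_join,
    comap_top_join, comap_top_join] at e
  have hsum := (((isOrbitSum_addRight_four.prod a).sumElim
    (isOrbitSum_addRight_two.prod b')).sumElim (IsOrbitSum.one hc)).sumElim ho
  have h4 : ∀ e : Fin 4, e + 1 + 1 + 1 + 1 = e := by decide
  have h2 : ∀ e : Fin 2, e + 1 + 1 = e := by decide
  refine ((hasSymmetricPlacement_comap_top ?_ hsum (hp.inr _) (fun κ => ?_)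
    (ha.imp (fun ha => ?_) fun h => ?_)).of_iso e).achirallyEmbeddable
  · ext1 κ
    rcases κ with ((⟨e, i⟩ | ⟨e, i⟩) | i) | i <;> simp [pow_succ, h4, h2, hτ]
  · rcases κ with ((⟨e, i⟩ | ⟨e, i⟩) | i) | i <;>
      simp [card_filter_sumMap, card_filter_prodMap_id, card_filter_sigma_fst, hb', mul_comm, hq,
        Equiv.symm_apply_eq]
  · rintro (((⟨e, i⟩ | ⟨e, i⟩) | i) | i) h
    · simp [ha] at h
    all_goals simp [h2, hτ]
  · rwa [← comap_top_comp ω (Sum.inr_injective)] at h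

end Colouring

/-! ### Vertices on the fixed circle -/

section CirclePart

open scoped Finset

variable {W K : Type*}

theorem adj_of_mem_edgeCone {H : SimpleGraph W} {a : W →₀ ℝ} (ha : a ∈ edgeCone H) {u v : W}
    (huv : u ≠ v) (hu : 0 < a u) (hv : 0 < a v) : H.Adj u v :=
  ha.2.2 (by simpa using hu.ne') (by simpa using hv.ne') huv

theorem eq_of_sub_eq_sub_of_not_adj {H : SimpleGraph W} {a b : W →₀ ℝ} (ha : a ∈ edgeCone H)
    (hb : b ∈ edgeCone H) {u v : W} (huv : u ≠ v) (hadj : ¬H.Adj u v)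
    (h : a u - b u = a v - b v) : a u = b u := by
  have hle : ∀ {a b : W →₀ ℝ}, a ∈ edgeCone H → b ∈ edgeCone H → a u - b u = a v - b v →
      a u ≤ b u := by
    intro a b ha hb h
    by_contra! hlt
    exact hadj (adj_of_mem_edgeCone ha huv ((hb.1 u).trans_lt hlt)
      ((hb.1 v).trans_lt (by linarith)))
  exact (hle ha hb h).antisymm (hle hb ha (by linarith))

/-- Equally spaced points near a fixed point of the reflection `(x, y) ↦ (-x, y)`. -/
noncomputable def nearPole (n : ℕ) (l : Fin n) : ℝ × ℝ := ((2 * l - (n - 1)) / 10, 1)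

theorem nearPole_rev {n : ℕ} (l : Fin n) :
    nearPole n l.rev = (-(nearPole n l).1, (nearPole n l).2) := by
  simp only [nearPole, Fin.val_rev, Nat.cast_sub (Nat.succ_le_of_lt l.2), Prod.mk.injEq, and_true]
  push_cast
  ring

theorem edgesAvoidOrbitPlanes_nearPole {n : ℕ} (hn : n ≤ 3) (H : SimpleGraph (Fin n)) :
    EdgesAvoidOrbitPlanes H (nearPole n) := by
  intro b hb
  refine avoidsOrbitPlanes_of_fst_le ?_
  have hfst : ∀ l, |(nearPole n l).1| ≤ 1 / 5 := fun l => by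
    have hl : (l + 1 : ℝ) ≤ n := by exact_mod_cast l.2
    have hn' : (n : ℝ) ≤ 3 := by exact_mod_cast hn
    simp only [nearPole, abs_le]
    constructor <;> linarith [(l : ℕ).cast_nonneg (α := ℝ)]
  rw [Finsupp.linearCombination_apply, Finsupp.sum_fintype _ _ (by simp), Prod.fst_sum,
    Prod.snd_sum]
  calc 5 * |∑ l, (b l • nearPole n l).1|
      ≤ 5 * ∑ l, b l * |(nearPole n l).1| := by
        refine mul_le_mul_of_nonneg_left ((Finset.abs_sum_le_sum_abs _ _).trans_eq ?_) (by norm_num)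
        simp [abs_mul, abs_of_nonneg (hb.1 _)]
    _ ≤ 5 * ∑ l, b l * (1 / 5) := by
        gcongr with l
        · exact hb.1 l
        · exact hfst l
    _ = ∑ l, (b l • nearPole n l).2 := by
        simp [nearPole, ← Finset.sum_mul, mul_comm (5 : ℝ)]
    _ ≤ _ := le_abs_self _

theorem isConeEmbedding_nearPole {n : ℕ} (hn : n ≤ 3) {H : SimpleGraph (Fin n)}
    (hH : ∀ u v, H.Adj u v → (u : ℕ) ≤ v + 1) : IsConeEmbedding H (nearPole n) := by
  intro a ha b hb h
  obtain ⟨hmoment, hsum⟩ : ∑ l, a l * (2 * l - (n - 1)) = ∑ l, b l * (2 * l - (n - 1)) ∧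
      ∑ l, a l = ∑ l, b l := by
    simpa [nearPole, Finsupp.linearCombination_apply, Finsupp.sum_fintype, Prod.ext_iff,
      Prod.fst_sum, Prod.snd_sum, ← Finset.sum_div, mul_div_assoc'] using h
  refine Finsupp.ext fun l => ?_
  interval_cases n
  · exact l.elim0
  · rw [Subsingleton.elim l 0]
    simpa using hsum
  · norm_num [Fin.sum_univ_two] at hmoment hsum
    match l with | 0 | 1 => linarith
  · norm_num [Fin.sum_univ_three] at hmoment hsum
    have h20 : a 2 = b 2 := eq_of_sub_eq_sub_of_not_adj ha hb (v := 0) (by decide)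
      (fun hadj => absurd (hH 2 0 hadj) (by decide)) (by linarith)
    match l with | 0 | 1 | 2 => linarith

theorem isCirclePart_nearPole {n : ℕ} (hn : n ≤ 3) {τ : Equiv.Perm K} {ω : Fin n → K}
    (hω : ∀ w, ω w.rev = τ (ω w)) (hω' : ∀ u v, ω u ≠ ω v → (u : ℕ) ≤ v + 1) :
    IsCirclePart τ ω (nearPole n) where
  isConeEmbedding := isConeEmbedding_nearPole hn hω'
  avoidsOrbitPlanes := (edgesAvoidOrbitPlanes_nearPole hn ⊥).avoidsOrbitPlanes
  exists_reflection w := ⟨w.rev, nearPole_rev w, hω w⟩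

theorem achirallyEmbeddable_of_nearPole {V : Type*} {γ : SimpleGraph V} {k₁ k₂ k₃ n : ℕ}
    {a : Fin k₁ → ℕ} {b : Fin k₂ → ℕ} {c : Fin k₃ → ℕ} {q : Fin 3 → ℕ}
    (hγ : Nonempty (γ ≃g
      ((((completeMultipartite a).joinCopies 4).join ((completeMultipartite b).joinCopies 2)).join
        (completeMultipartite c)).join (completeMultipartite q)))
    (hb : ∀ i, Even (b i)) (hc : ∀ i, 4 ∣ c i) (σ : Equiv.Perm (Fin 3)) {τ : Equiv.Perm (Fin 3)}
    (hτ : ∀ i, τ (τ i) = i) {o : Fin 3 → ℕ} (ho : IsOrbitSum τ o) (hn : n ≤ 3) {ω : Fin n → Fin 3}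
    (hω : ∀ w, ω w.rev = τ (ω w)) (hω' : ∀ u v, ω u ≠ ω v → (u : ℕ) ≤ v + 1)
    (hq : ∀ i, q (σ i) = o i + #{w | ω w = i}) : γ.AchirallyEmbeddable :=
  achirallyEmbeddable_of_isCirclePart hγ hb hc σ hτ ho (isCirclePart_nearPole hn hω hω') hq
    (.inr (edgesAvoidOrbitPlanes_nearPole hn _))

/-- Three points whose positive combination with coefficients `(2, 1, 1)` vanishes. -/
noncomputable def trianglePoint : Fin 3 → ℝ × ℝ := ![(0, 1), (4, -1), (-4, -1)]

theorem isConeEmbedding_trianglePoint (H : SimpleGraph (Fin 3)) :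
    IsConeEmbedding H trianglePoint := by
  have hker : ∀ {a b : Fin 3 →₀ ℝ}, Finsupp.linearCombination ℝ trianglePoint a =
      Finsupp.linearCombination ℝ trianglePoint b →
        a 0 - b 0 = 2 * (a 1 - b 1) ∧ a 2 - b 2 = a 1 - b 1 := by
    intro a b h
    have hcoord : a 1 * 4 - a 2 * 4 = b 1 * 4 - b 2 * 4 ∧ a 0 - a 1 - a 2 = b 0 - b 1 - b 2 := by
      simpa [trianglePoint, Finsupp.linearCombination_apply, Finsupp.sum_fintype,
        Fin.sum_univ_three, ← sub_eq_add_neg] using h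
    constructor <;> linarith
  have hle : ∀ {a b}, a ∈ edgeCone H → b ∈ edgeCone H →
      Finsupp.linearCombination ℝ trianglePoint a = Finsupp.linearCombination ℝ trianglePoint b →
        a 1 ≤ b 1 := by
    intro a b ha hb h
    obtain ⟨h0, h2⟩ := hker h
    by_contra! hlt
    have hsupp : a.support = Finset.univ := by
      refine Finset.eq_univ_iff_forall.mpr fun l => Finsupp.mem_support_iff.mpr (ne_of_gt ?_)
      have hl : b l < a l := by match l with | 0 | 1 | 2 => linarith
      exact (hb.1 l).trans_lt hl
    simpa [hsupp] using ha.2.1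
  intro a ha b hb h
  obtain ⟨h0, h2⟩ := hker h
  have h1 : a 1 = b 1 := (hle ha hb h).antisymm (hle hb ha h.symm)
  exact Finsupp.ext fun | 0 | 1 | 2 => by linarith

theorem isCirclePart_trianglePoint {τ : Equiv.Perm K} {ω : Fin 3 → K}
    (hω : ∀ w, ω (![0, 2, 1] w) = τ (ω w)) : IsCirclePart τ ω trianglePoint where
  isConeEmbedding := isConeEmbedding_trianglePoint _
  avoidsOrbitPlanes w := by
    fin_cases w
    · exact avoidsOrbitPlanes_of_fst_le (by simp [trianglePoint])
    all_goals exact avoidsOrbitPlanes_of_snd_le (by simp [trianglePoint])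
  exists_reflection w := ⟨![0, 2, 1] w, by fin_cases w <;> simp [trianglePoint], hω w⟩

/-- The vertices of a square centred at the origin. -/
noncomputable def quadranglePoint : Fin 4 → ℝ × ℝ := ![(1, 0), (0, 1), (-1, 0), (0, -1)]

theorem isConeEmbedding_quadranglePoint {H : SimpleGraph (Fin 4)} (h02 : ¬H.Adj 0 2)
    (h13 : ¬H.Adj 1 3) : IsConeEmbedding H quadranglePoint := by
  intro a ha b hb h
  have hcoord : a 0 - a 2 = b 0 - b 2 ∧ a 1 - a 3 = b 1 - b 3 := by
    simpa [quadranglePoint, Finsupp.linearCombination_apply, Finsupp.sum_fintype,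
      Fin.sum_univ_four, ← sub_eq_add_neg] using h
  have h0 := eq_of_sub_eq_sub_of_not_adj ha hb (by decide) h02 (by linarith)
  have h1 := eq_of_sub_eq_sub_of_not_adj ha hb (by decide) h13 (by linarith)
  exact Finsupp.ext fun | 0 | 1 | 2 | 3 => by linarith

theorem isCirclePart_quadranglePoint {τ : Equiv.Perm K} {ω : Fin 4 → K}
    (hω : ∀ w, ω (![2, 1, 0, 3] w) = τ (ω w)) (h02 : ω 0 = ω 2) (h13 : ω 1 = ω 3) :
    IsCirclePart τ ω quadranglePoint where
  isConeEmbedding := isConeEmbedding_quadranglePoint (by simpa using h02) (by simpa using h13)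
  avoidsOrbitPlanes w := by
    fin_cases w
    · exact avoidsOrbitPlanes_of_snd_le (by simp [quadranglePoint])
    · exact avoidsOrbitPlanes_of_fst_le (by simp [quadranglePoint])
    · exact avoidsOrbitPlanes_of_snd_le (by simp [quadranglePoint])
    · exact avoidsOrbitPlanes_of_fst_le (by simp [quadranglePoint])
  exists_reflection w := ⟨![2, 1, 0, 3] w, by fin_cases w <;> simp [quadranglePoint], hω w⟩

end CirclePart

theorem theorem1 {V : Type*} (γ : SimpleGraph V) {k₁ k₂ k₃ : ℕ}
    (a : Fin k₁ → ℕ) (b : Fin k₂ → ℕ) (c : Fin k₃ → ℕ) (q : Fin 3 → ℕ)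
    (hγ : Nonempty (γ ≃g
      ((((completeMultipartite a).joinCopies 4).join ((completeMultipartite b).joinCopies 2)).join
        (completeMultipartite c)).join (completeMultipartite q)))
    (hb : ∀ i, Even (b i)) (hc : ∀ i, 4 ∣ c i)
    (hq : ∃ σ : Equiv.Perm (Fin 3),
      (q (σ 1) = 0 ∧ q (σ 2) = 0) ∨
      (Odd (q (σ 0)) ∧ q (σ 1) = q (σ 0) ∧ q (σ 2) = 0) ∨
      (Odd (q (σ 0)) ∧ q (σ 1) = q (σ 0) ∧ q (σ 2) ≡ 1 [MOD 4] ∧ ∀ i, a i = 0) ∨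
      (q (σ 0) ≡ 2 [MOD 4] ∧ q (σ 1) ≡ 1 [MOD 4] ∧ q (σ 2) = 0) ∨
      (q (σ 0) ≡ 2 [MOD 4] ∧ q (σ 1) ≡ 2 [MOD 4] ∧ q (σ 2) = 0 ∧ ∀ i, a i = 0)) :
    γ.AchirallyEmbeddable := by
  unfold Nat.ModEq at hq
  obtain ⟨σ, ⟨h1, h2⟩ | ⟨⟨l, h0⟩, h1, h2⟩ | ⟨⟨l, h0⟩, h1, h2, ha⟩ | ⟨h0, h1, h2⟩ |
    ⟨h0, h1, h2, ha⟩⟩ := hq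
  · refine achirallyEmbeddable_of_nearPole hγ hb hc σ (n := q (σ 0) % 4) (ω := fun _ => 0)
      (fun _ => rfl) (isOrbitSum_one_fin_three (q (σ 0) / 4) 0) (by omega) (by simp) (by simp) ?_
    simp [Fin.forall_fin_succ, h1, h2, Nat.div_add_mod]
  · refine achirallyEmbeddable_of_nearPole hγ hb hc σ (n := 2) (ω := ![0, 1])
      (by decide) (isOrbitSum_swap l 0) (by norm_num) (by decide) (by decide) fun i => ?_
    fin_cases i <;> simp [h0, h1, h2, Finset.card_filter, Fin.sum_univ_two, -Finset.sum_boole]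
  · refine achirallyEmbeddable_of_isCirclePart hγ hb hc σ (by decide)
      (isOrbitSum_swap l (q (σ 2) / 4)) (isCirclePart_trianglePoint (ω := ![2, 0, 1]) (by decide))
      (fun i => ?_) (.inl ha)
    fin_cases i <;> simp [h0, h1, Finset.card_filter, Fin.sum_univ_three, -Finset.sum_boole]
    omega
  · refine achirallyEmbeddable_of_nearPole hγ hb hc σ (n := 3) (ω := ![0, 1, 0]) (fun _ => rfl)
      (isOrbitSum_one_fin_three (q (σ 0) / 4) (q (σ 1) / 4)) le_rfl (by decide) (by decide)
      fun i => ?_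
    fin_cases i <;> simp [h2, Finset.card_filter, Fin.sum_univ_three, -Finset.sum_boole] <;> omega
  · refine achirallyEmbeddable_of_isCirclePart hγ hb hc σ (fun _ => rfl)
      (isOrbitSum_one_fin_three (q (σ 0) / 4) (q (σ 1) / 4))
      (isCirclePart_quadranglePoint (ω := ![0, 1, 0, 1]) (by decide) rfl rfl)
      (fun i => ?_) (.inl ha)
    fin_cases i <;> simp [h2, Finset.card_filter, Fin.sum_univ_four, -Finset.sum_boole] <;> omega
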